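/- **Center of dilatation in a plane-strain cubic material.** Let $\mu>0$, $\lambda+\mu>0$, $\mu^*>0$, $\mu^*\neq\mu$. The plane-strain equilibrium equations of a cubic material with body force $(f_1,f_2)$ are $$(\lambda+2\mu)u_{1,11}+\mu^*u_{1,22}+(\lambda+\mu^*)u_{2,12}+f_1=0,\qquad (\lambda+2\mu)u_{2,22}+\mu^*u_{2,11}+(\lambda+\mu^*)u_{1,12}+f_2=0.\tag{E}$$ Put $p=2\lambda\mu^*-4\mu(\lambda+\mu)$, $q=16\mu(\mu-\mu^*)(\lambda+\mu)(\lambda+\mu+\mu^*)$, $$s_{1,2}=\frac{\sqrt{-p\mp\sqrt q}}{\sqrt{2\mu^*(\lambda+2\mu)}},\quad Y^{(1)}_m=\frac{(\lambda+2\mu)s_m^2-\mu^*}{s_m},\quad Y^{(2)}_m=\frac{\mu^*s_m^2-(\lambda+2\mu)}{s_m},\quad r_m=\sqrt{x_1^2+s_m^2x_2^2},\quad \theta_m=\arctan\frac{s_mx_2}{x_1},$$ with principal branches (if $\mu^*>\mu$ then $q<0$ and $s_1,s_2$ are complex conjugate); on the axis $x_1=0$ the difference $\theta_2-\theta_1$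 is taken to be $0$, its continuous extension. The Green's function for a concentrated force $P=(P_1,P_2)$ at the origin is $u^{(P)}=u^{(P_1)}+u^{(P_2)}$, where $$u^{(P_1)}=\frac{P_1}{2\pi\sqrt q}\bigl(Y^{(1)}_1\log r_1-Y^{(1)}_2\log r_2,\ (\lambda+\mu^*)(\theta_2-\theta_1)\bigr),\qquad u^{(P_2)}=\frac{P_2}{2\pi\sqrt q}\bigl((\lambda+\mu^*)(\theta_2-\theta_1),\ Y^{(2)}_1\log r_1-Y^{(2)}_2\log r_2\bigr).$$ It is real-valued and locally integrable, and it satisfies (E) on $\mathbb R^2$ in the sense of distributions with $f=P\,\delta$. For $d\in\mathbb R$ let $u^{(D)}$ be the displacement of two orthogonal moment-free dipoles of unit forces: with $P_1=P_2=1$, $$u^{(D)}(x)=u^{(P_1)}(x_1-\tfrac d4,x_2)-u^{(P_1)}(x_1+\tfrac d4,x_2)+u^{(P_2)}(x_1,x_2-\tfrac d4)-u^{(P_2)}(x_1,x_2+\tfrac d4).$$ Then for every $x\neq(0,0)$ the map $d\mapsto u^{(D)}(x)$ is differentiable near $d=0$, and both its derivative at $d=0$ (the coefficient of the linear term) and $\lim_{d\to0}\frac{\mathrm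 d}{\mathrm dd}u^{(D)}(x)$ are equal to the field $u(x)=(u_1,u_2)$ given by $$u_1=\frac{x_1}{4\pi\sqrt q}\left(\frac{(\lambda+\mu^*)s_1-Y^{(1)}_1}{r_1^2}-\frac{(\lambda+\mu^*)s_2-Y^{(1)}_2}{r_2^2}\right),$$ $$u_2=\frac{x_2}{4\pi\sqrt q}\left((\lambda+\mu^*)\Bigl(\frac{s_2}{r_2^2}-\frac{s_1}{r_1^2}\Bigr)-\frac{(Y^{(2)}_1-Y^{(2)}_2)s_1^2}{r_1^2}\right)+\frac{Y^{(2)}_2}{4\pi\mu^*(\lambda+2\mu)}\,\frac{x_1^2x_2}{r_1^2r_2^2}.$$ The derivative at $d=0$ is the same if the two dipoles are rigidly rotated by any angle. The field $u$ is real-valued and locally integrable, and it satisfies (E) on $\mathbb R^2$ in the sense of distributions with $f=-\tfrac12\nabla\delta$, that is, $\langle f_i,\varphi\rangle=\tfrac12\,\partial_i\varphi(0)$ (the center of dilatation of unit strength in this normalization). Isotropic limit: with $\lambda,\mu$ fixed and $\mu^*\to\mu$ (through $\mu^*\neq\mu$), for $m=1,2$ one has $s_m\to1$, $q\to0$, $Y^{(1)}_m\to\lambda+\mu$,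 $Y^{(2)}_m\to-(\lambda+\mu)$, $r_m\to r=\sqrt{x_1^2+x_2^2}$, and for every $x\ne(0,0)$ $$u(x)\to\frac{(x_1,x_2)}{4\pi(\lambda+2\mu)\,r^2}.$$ -/

import Mathlib

open MeasureTheory Filter Topology
open scoped ContDiff

namespace CubicDilatation

noncomputable section

/-! Plane-strain linear elasticity of a cubic material with moduli `lam`, `mu`, `mus`
(written `λ`, `μ`, `μ*` in mathematics). Points of the plane are pairs `x = (x₁, x₂)`.
The characteristic roots may be complex, so displacements are written as complex numbers;
that they are real is a part of the theorem. `Complex.sqrt`, `Complex.log` and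
`Complex.arctan` are the principal branches. -/

/-- `p = 2 λ μ* - 4 μ (λ + μ)`. -/
def pCoef (lam mu mus : ℝ) : ℝ := 2 * lam * mus - 4 * mu * (lam + mu)

/-- `q = 16 μ (μ - μ*) (λ + μ) (λ + μ + μ*)`. -/
def qCoef (lam mu mus : ℝ) : ℝ := 16 * mu * (mu - mus) * (lam + mu) * (lam + mu + mus)

/-- The square root of `q`, a nonnegative real or a purely imaginary number. -/
def sqrtQ (lam mu mus : ℝ) : ℂ := Complex.sqrt (qCoef lam mu mus)

/-- `s₁ = √(-p - √q) / √(2 μ* (λ + 2 μ))`. -/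
def s₁ (lam mu mus : ℝ) : ℂ :=
  1 / Complex.sqrt ((2 * mus * (lam + 2 * mu) : ℝ) : ℂ) *
    Complex.sqrt (-(pCoef lam mu mus : ℂ) - sqrtQ lam mu mus)

/-- `s₂ = √(-p + √q) / √(2 μ* (λ + 2 μ))`. -/
def s₂ (lam mu mus : ℝ) : ℂ :=
  1 / Complex.sqrt ((2 * mus * (lam + 2 * mu) : ℝ) : ℂ) *
    Complex.sqrt (-(pCoef lam mu mus : ℂ) + sqrtQ lam mu mus)

/-- `Y⁽¹⁾ = ((λ + 2 μ) s² - μ*) / s`, to be used at `s = s₁` and `s = s₂`. -/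
def Y1 (lam mu mus : ℝ) (s : ℂ) : ℂ := ((lam + 2 * mu) * s ^ 2 - mus) / s

/-- `Y⁽²⁾ = (μ* s² - (λ + 2 μ)) / s`, to be used at `s = s₁` and `s = s₂`. -/
def Y2 (lam mu mus : ℝ) (s : ℂ) : ℂ := (mus * s ^ 2 - (lam + 2 * mu)) / s

/-- `r_m = √(x₁² + s_m² x₂²)`. -/
def rad (s : ℂ) (x : ℝ × ℝ) : ℂ := Complex.sqrt ((x.1 : ℂ) ^ 2 + s ^ 2 * (x.2 : ℂ) ^ 2)

/-- `θ_m = arctan (s_m x₂ / x₁)`. On the axis `x₁ = 0` this is `0` by the convention for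
division; only the difference `θ₂ - θ₁` is used below, and its continuous extension to the
punctured axis `x₁ = 0` is indeed `0`. -/
def ang (s : ℂ) (x : ℝ × ℝ) : ℂ := Complex.arctan (s * (x.2 : ℂ) / (x.1 : ℂ))

/-- The Green's function: displacement at `x` due to the concentrated force `P = (P₁, P₂)`
acting at the origin of the infinite body. -/
def pointForce (lam mu mus : ℝ) (P : ℝ × ℝ) (x : ℝ × ℝ) : ℂ × ℂ :=
  let S₁ := s₁ lam mu mus
  let S₂ := s₂ lam mu mus
  let R := sqrtQ lam mu mus
  (P.1 / (2 * Real.pi * R) *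
        (Y1 lam mu mus S₁ * Complex.log (rad S₁ x) - Y1 lam mu mus S₂ * Complex.log (rad S₂ x))
      + P.2 * (lam + mus) / (2 * Real.pi * R) * (ang S₂ x - ang S₁ x),
   P.1 * (lam + mus) / (2 * Real.pi * R) * (ang S₂ x - ang S₁ x)
      + P.2 / (2 * Real.pi * R) *
        (Y2 lam mu mus S₁ * Complex.log (rad S₁ x) - Y2 lam mu mus S₂ * Complex.log (rad S₂ x)))

/-- Displacement `u⁽ᴰ⁾` of two orthogonal moment-free dipoles of unit forces: the unit forces
`±e₁` act at `±(d/4) e₁` and the unit forces `±e₂` act at `±(d/4) e₂`. -/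
def dipolePair (lam mu mus : ℝ) (x : ℝ × ℝ) (d : ℝ) : ℂ × ℂ :=
  pointForce lam mu mus (1, 0) (x.1 - d / 4, x.2) - pointForce lam mu mus (1, 0) (x.1 + d / 4, x.2)
    + pointForce lam mu mus (0, 1) (x.1, x.2 - d / 4)
    - pointForce lam mu mus (0, 1) (x.1, x.2 + d / 4)

/-- The same two dipoles after a rigid rotation by the angle `a`: the axes `e₁`, `e₂` are replaced
by `(cos a, sin a)` and `(-sin a, cos a)`. -/
def rotatedDipolePair (lam mu mus a : ℝ) (x : ℝ × ℝ) (d : ℝ) : ℂ × ℂ :=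
  let e : ℝ × ℝ := (Real.cos a, Real.sin a)
  let f : ℝ × ℝ := (-Real.sin a, Real.cos a)
  pointForce lam mu mus e (x - (d / 4) • e) - pointForce lam mu mus e (x + (d / 4) • e)
    + pointForce lam mu mus f (x - (d / 4) • f) - pointForce lam mu mus f (x + (d / 4) • f)

/-- The closed algebraic form of the displacement of the center of dilatation. -/
def dilatationField (lam mu mus : ℝ) (x : ℝ × ℝ) : ℂ × ℂ :=
  let S₁ := s₁ lam mu mus
  let S₂ := s₂ lam mu mus
  let R := sqrtQ lam mu mus
  ((x.1 : ℂ) / (4 * Real.pi * R) *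
      (((lam + mus) * S₁ - Y1 lam mu mus S₁) / rad S₁ x ^ 2
        - ((lam + mus) * S₂ - Y1 lam mu mus S₂) / rad S₂ x ^ 2),
   (x.2 : ℂ) / (4 * Real.pi * R) *
      ((lam + mus) * (S₂ / rad S₂ x ^ 2 - S₁ / rad S₁ x ^ 2)
        - (Y2 lam mu mus S₁ - Y2 lam mu mus S₂) * S₁ ^ 2 / rad S₁ x ^ 2)
    + Y2 lam mu mus S₂ / (4 * Real.pi * mus * (lam + 2 * mu))
      * ((x.1 : ℂ) ^ 2 * (x.2 : ℂ) / (rad S₁ x ^ 2 * rad S₂ x ^ 2)))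

/-- The isotropic center of dilatation, `x / (4 π (λ + 2 μ) r²)` with `r² = x₁² + x₂²`. -/
def isotropicDilatationField (lam mu : ℝ) (x : ℝ × ℝ) : ℂ × ℂ :=
  (((x.1 / (4 * Real.pi * (lam + 2 * mu) * (x.1 ^ 2 + x.2 ^ 2)) : ℝ) : ℂ),
   ((x.2 / (4 * Real.pi * (lam + 2 * mu) * (x.1 ^ 2 + x.2 ^ 2)) : ℝ) : ℂ))

/-- Partial derivative in `x₁`. -/
def pd₁ (φ : ℝ × ℝ → ℝ) (x : ℝ × ℝ) : ℝ := fderiv ℝ φ x (1, 0)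

/-- Partial derivative in `x₂`. -/
def pd₂ (φ : ℝ × ℝ → ℝ) (x : ℝ × ℝ) : ℝ := fderiv ℝ φ x (0, 1)

/-- `u` satisfies in the whole plane, in the sense of distributions, the displacement equations of
equilibrium with body force `f = (f₁, f₂)`:
`(λ + 2μ) ∂₁₁u₁ + μ* ∂₂₂u₁ + (λ + μ*) ∂₁₂u₂ + f₁ = 0`,
`(λ + 2μ) ∂₂₂u₂ + μ* ∂₁₁u₂ + (λ + μ*) ∂₁₂u₁ + f₂ = 0`.
Here `f₁ φ` is the value of the distribution `f₁` at the test function `φ`, and likewise `f₂`. -/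
def IsEquilibrium (lam mu mus : ℝ) (u : ℝ × ℝ → ℂ × ℂ) (f₁ f₂ : (ℝ × ℝ → ℝ) → ℝ) : Prop :=
  LocallyIntegrable u volume ∧
  ∀ φ : ℝ × ℝ → ℝ, ContDiff ℝ ∞ φ → HasCompactSupport φ →
    (∫ x, ((((lam + 2 * mu) * pd₁ (pd₁ φ) x + mus * pd₂ (pd₂ φ) x : ℝ) : ℂ) * (u x).1
        + (((lam + mus) * pd₁ (pd₂ φ) x : ℝ) : ℂ) * (u x).2) ∂volume) + (f₁ φ : ℂ) = 0 ∧
    (∫ x, ((((lam + 2 * mu) * pd₂ (pd₂ φ) x + mus * pd₁ (pd₁ φ) x : ℝ) : ℂ) * (u x).2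
        + (((lam + mus) * pd₁ (pd₂ φ) x : ℝ) : ℂ) * (u x).1) ∂volume) + (f₂ φ : ℂ) = 0

end

end CubicDilatation

namespace CubicDilatation

open Complex (I)
open scoped ComplexConjugate

section

/-! ### Locally integrable functions with a weak singularity at the origin -/

/-! Write `a = λ + 2μ`, `b = μ*`, `c = λ + μ*`, `R = √q`, and let `s`, `t` be the two characteristic
roots. All that is needed about them is collected in `IsCharPair`: positive real parts, `s t = 1`,
`a b (t² - s²) = R`, the characteristic equation, and the behaviour under conjugation.

The Green's function is a combination of three potentials: `log r_s`, `log r_t` and `θ_t - θ_s`.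
Each is rewritten through principal logarithms of complex quadratic forms whose values off the
origin lie in the slit plane (`log_rad`, `IsCharPair.ang_sub_ang`). So the potentials are smooth off
the origin, and both they and their gradients, of order `‖x‖⁻¹`, are locally integrable in the
plane. Integration by parts on the lines that miss the origin shows that the pointwise gradient is
the weak gradient (`integral_pd₁_mul`, `integral_pd₂_mul`). A delta can arise only at the second
derivative, and it comes from a single identity: the radial field `s x / (x₁² + s² x₂²)` has
divergence `2π δ` (`integral_radial_flux`). Together with the symmetry of second derivatives this
reduces all pairings to four numbers and `φ(0)` (`IsCharPair.exists_pairings`). The equilibrium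
equations then become algebraic identities: the characteristic equation cancels the four numbers,
and `a b (t² - s²) = R` normalizes the delta (`IsCharPair.weak_force`).

The center of dilatation is `-1/2` times the sum of the derivatives of the unit-force fields, each
along its own force. This sum is a trace over an orthonormal frame, hence rotation invariant
(`dilatationField_eq_grad`). Its equations follow by testing those of the point forces against
`∂ᵢφ`. Reality holds because conjugation either fixes `s`, `t`, `R` or exchanges `s` and `t` while
negating `R`. For the isotropic limit the factor `t - s` hidden in `R` is cancelled beforehand
(`dilatationField_eq_regular`). -/

theorem locallyIntegrable_norm_add_inv :
    LocallyIntegrable (fun x : ℝ × ℝ => ‖x‖ + ‖x‖⁻¹) volume := by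
  have h : LocallyIntegrable (fun x : ℝ × ℝ => ‖x‖⁻¹) volume :=
    locallyIntegrable_of_norm_le_rpow (C := 1) (α := 1) (by simp) (by simp)
      (.of_forall fun x => by simp [Real.rpow_neg_one])
      measurable_norm.inv.aestronglyMeasurable
  exact continuous_norm.locallyIntegrable.add h

/-- The single majorant `‖x‖ + ‖x‖⁻¹` serves both the logarithms and the kernels homogeneous of
degree `-1`. Continuity off the origin suffices for measurability because a point is null. -/
theorem locallyIntegrable_of_norm_le {f : ℝ × ℝ → ℂ} (hf : ContinuousOn f {0}ᶜ) {C : ℝ}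
    (h : ∀ x, x ≠ 0 → ‖f x‖ ≤ C * (‖x‖ + ‖x‖⁻¹)) : LocallyIntegrable f volume := by
  have hm : AEStronglyMeasurable f volume := by
    have h1 := hf.aestronglyMeasurable (μ := volume) (measurableSet_singleton 0).compl
    rwa [Measure.restrict_eq_self_of_ae_mem] at h1
    filter_upwards [Measure.ae_ne volume (0 : ℝ × ℝ)] with x hx using hx
  have hC : LocallyIntegrable (fun x : ℝ × ℝ => C * (‖x‖ + ‖x‖⁻¹)) volume :=
    locallyIntegrable_norm_add_inv.smul C
  refine hC.mono hm ?_
  filter_upwards [Measure.ae_ne volume (0 : ℝ × ℝ)] with x hx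
  exact (h x hx).trans (Real.le_norm_self _)

theorem integrable_test_mul {f : ℝ × ℝ → ℂ} (hf : LocallyIntegrable f volume) {ψ : ℝ × ℝ → ℝ}
    (hψ : Continuous ψ) (hc : HasCompactSupport ψ) :
    Integrable (fun x => (ψ x : ℂ) * f x) volume := by
  simpa using hf.integrable_smul_left_of_hasCompactSupport hψ hc

/-! ### Test functions -/

theorem contDiff_pd₁ {φ : ℝ × ℝ → ℝ} (hφ : ContDiff ℝ ∞ φ) : ContDiff ℝ ∞ (pd₁ φ) :=
  (hφ.fderiv_right (m := ∞) (by simp)).clm_apply contDiff_const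

theorem contDiff_pd₂ {φ : ℝ × ℝ → ℝ} (hφ : ContDiff ℝ ∞ φ) : ContDiff ℝ ∞ (pd₂ φ) :=
  (hφ.fderiv_right (m := ∞) (by simp)).clm_apply contDiff_const

theorem hasCompactSupport_pd₁ {φ : ℝ × ℝ → ℝ} (hφ : HasCompactSupport φ) :
    HasCompactSupport (pd₁ φ) := hφ.fderiv_apply ℝ _

theorem hasCompactSupport_pd₂ {φ : ℝ × ℝ → ℝ} (hφ : HasCompactSupport φ) :
    HasCompactSupport (pd₂ φ) := hφ.fderiv_apply ℝ _

theorem pd₁_pd₂_comm {φ : ℝ × ℝ → ℝ} (hφ : ContDiff ℝ ∞ φ) : pd₁ (pd₂ φ) = pd₂ (pd₁ φ) := by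
  funext x
  have hd : DifferentiableAt ℝ (fderiv ℝ φ) x :=
    ((hφ.fderiv_right (m := ∞) (by simp)).differentiable (by simp)) x
  have hs : IsSymmSndFDerivAt ℝ φ x :=
    hφ.contDiffAt.isSymmSndFDerivAt (by
      simp only [minSmoothness_of_isRCLikeNormedField]
      exact WithTop.coe_le_coe.2 le_top)
  have e : ∀ v w : ℝ × ℝ, fderiv ℝ (fun y => fderiv ℝ φ y v) x w = fderiv ℝ (fderiv ℝ φ) x w v := by
    intro v w
    rw [fderiv_clm_apply hd (by fun_prop)]
    simp
  unfold pd₁ pd₂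
  rw [e, e]
  exact hs _ _

/-! ### Weak derivatives of functions smooth off the origin -/

theorem integral_deriv_mul_add_eq_zero {ψ : ℝ → ℝ} {ψ' : ℝ → ℝ} {v v' : ℝ → ℂ}
    (hψ : ∀ t, HasDerivAt ψ (ψ' t) t) (hψ' : Continuous ψ') (hc : HasCompactSupport ψ)
    (hv : ∀ t, HasDerivAt v (v' t) t) (hv' : Continuous v') :
    ∫ t, (ψ' t : ℂ) * v t = -∫ t, (ψ t : ℂ) * v' t := by
  have hψc : Continuous ψ := continuous_iff_continuousAt.2 fun t => (hψ t).continuousAt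
  have hvc : Continuous v := continuous_iff_continuousAt.2 fun t => (hv t).continuousAt
  have hc' : HasCompactSupport ψ' := by
    have : ψ' = deriv ψ := funext fun t => (hψ t).deriv.symm
    rw [this]; exact hc.deriv
  have key : ∀ {g : ℝ → ℝ} {w : ℝ → ℂ}, Continuous g → HasCompactSupport g → Continuous w →
      Integrable ((fun t => (g t : ℂ)) * w) := fun {g w} hg hgc hw =>
    ((Complex.continuous_ofReal.comp hg).mul hw).integrable_of_hasCompactSupport
      ((hgc.comp_left (g := fun r : ℝ => (r : ℂ)) (by simp)).mul_right)
  have := integral_mul_deriv_eq_deriv_mul_of_integrable (u := fun t => (ψ t : ℂ))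
    (u' := fun t => (ψ' t : ℂ)) (v := v) (v' := v') (fun t _ => (hψ t).ofReal_comp)
    (fun t _ => hv t) (key hψc hc hv') (key hψ' hc' hvc) (key hψc hc hvc)
  rw [this, neg_neg]

theorem hasCompactSupport_of_norm_le {φ : ℝ × ℝ → ℝ} (hc : HasCompactSupport φ) {g : ℝ → ℝ × ℝ}
    (hg : ∀ t, |t| ≤ ‖g t‖) : HasCompactSupport fun t => φ (g t) := by
  obtain ⟨R, hR0, hR⟩ := hc.isCompact.isBounded.exists_pos_norm_lt
  refine HasCompactSupport.intro (K := Set.Icc (-R) R) isCompact_Icc fun t ht => ?_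
  by_contra hne
  have := hR _ (subset_tsupport _ hne)
  exact ht (abs_le.1 ((hg t).trans this.le))

variable {f g : ℝ × ℝ → ℂ}

/-- By Fubini one integrates by parts on each horizontal line. Only the line through the origin
meets the singularity, and it is one of a null set of lines, so no boundary term appears. -/
theorem integral_pd₁_mul (hf : LocallyIntegrable f volume) (hg : LocallyIntegrable g volume)
    (hgc : ContinuousOn g {0}ᶜ)
    (hd : ∀ x : ℝ × ℝ, x ≠ 0 → HasDerivAt (fun t => f (t, x.2)) (g x) x.1)
    {φ : ℝ × ℝ → ℝ} (hφ : ContDiff ℝ ∞ φ) (hc : HasCompactSupport φ) :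
    ∫ x, (pd₁ φ x : ℂ) * f x = -∫ x, (φ x : ℂ) * g x := by
  have i1 := integrable_test_mul hf (contDiff_pd₁ hφ).continuous (hasCompactSupport_pd₁ hc)
  have i2 := integrable_test_mul hg hφ.continuous hc
  rw [Measure.volume_eq_prod] at i1 i2 ⊢
  rw [integral_prod_symm _ i1, integral_prod_symm _ i2, ← integral_neg]
  refine integral_congr_ae ?_
  filter_upwards [Measure.ae_ne volume (0 : ℝ)] with y hy
  have hne : ∀ t : ℝ, ((t, y) : ℝ × ℝ) ≠ 0 := fun t h => hy (congrArg Prod.snd h)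
  refine integral_deriv_mul_add_eq_zero (ψ := fun t => φ (t, y)) (v := fun t => f (t, y))
    (fun t => ?_) ?_ ?_ (fun t => hd (t, y) (hne t)) ?_
  · have h1 : HasDerivAt (fun t : ℝ => ((t, y) : ℝ × ℝ)) (1, 0) t :=
      (hasDerivAt_id t).prodMk (hasDerivAt_const t y)
    exact ((hφ.differentiable (by simp)) (t, y)).hasFDerivAt.comp_hasDerivAt t h1
  · exact (contDiff_pd₁ hφ).continuous.comp (by fun_prop)
  · exact hasCompactSupport_of_norm_le hc fun t => norm_fst_le ((t, y) : ℝ × ℝ)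
  · exact hgc.comp_continuous (by fun_prop) hne

theorem integral_pd₂_mul (hf : LocallyIntegrable f volume) (hg : LocallyIntegrable g volume)
    (hgc : ContinuousOn g {0}ᶜ)
    (hd : ∀ x : ℝ × ℝ, x ≠ 0 → HasDerivAt (fun t => f (x.1, t)) (g x) x.2)
    {φ : ℝ × ℝ → ℝ} (hφ : ContDiff ℝ ∞ φ) (hc : HasCompactSupport φ) :
    ∫ x, (pd₂ φ x : ℂ) * f x = -∫ x, (φ x : ℂ) * g x := by
  have i1 := integrable_test_mul hf (contDiff_pd₂ hφ).continuous (hasCompactSupport_pd₂ hc)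
  have i2 := integrable_test_mul hg hφ.continuous hc
  rw [Measure.volume_eq_prod] at i1 i2 ⊢
  rw [integral_prod _ i1, integral_prod _ i2, ← integral_neg]
  refine integral_congr_ae ?_
  filter_upwards [Measure.ae_ne volume (0 : ℝ)] with y hy
  have hne : ∀ t : ℝ, ((y, t) : ℝ × ℝ) ≠ 0 := fun t h => hy (congrArg Prod.fst h)
  refine integral_deriv_mul_add_eq_zero (ψ := fun t => φ (y, t)) (v := fun t => f (y, t))
    (fun t => ?_) ?_ ?_ (fun t => hd (y, t) (hne t)) ?_
  · have h1 : HasDerivAt (fun t : ℝ => ((y, t) : ℝ × ℝ)) (0, 1) t :=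
      (hasDerivAt_const t y).prodMk (hasDerivAt_id t)
    exact ((hφ.differentiable (by simp)) (y, t)).hasFDerivAt.comp_hasDerivAt t h1
  · exact (contDiff_pd₂ hφ).continuous.comp (by fun_prop)
  · exact hasCompactSupport_of_norm_le hc fun t => norm_snd_le ((y, t) : ℝ × ℝ)
  · exact hgc.comp_continuous (by fun_prop) hne

/-! ### Complex quadratic forms with values in the slit plane -/

/-- The quadratic form `α x₁² + β x₁ x₂ + γ x₂²`. -/
def quadForm (α β γ : ℂ) (x : ℝ × ℝ) : ℂ := α * x.1 ^ 2 + β * (x.1 * x.2) + γ * x.2 ^ 2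

variable {α β γ : ℂ}

theorem contDiff_quadForm {n : WithTop ℕ∞} : ContDiff ℝ n (quadForm α β γ) := by
  unfold quadForm
  have h1 : ContDiff ℝ n (fun x : ℝ × ℝ => (x.1 : ℂ)) := Complex.ofRealCLM.contDiff.comp contDiff_fst
  have h2 : ContDiff ℝ n (fun x : ℝ × ℝ => (x.2 : ℂ)) := Complex.ofRealCLM.contDiff.comp contDiff_snd
  fun_prop

/-- Compactness of the unit sphere and homogeneity of degree 2; the slit plane is used only for
nonvanishing. -/
theorem exists_le_norm_quadForm (h : ∀ x, x ≠ 0 → quadForm α β γ x ∈ Complex.slitPlane) :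
    ∃ κ, 0 < κ ∧ ∀ x, κ * ‖x‖ ^ 2 ≤ ‖quadForm α β γ x‖ := by
  have hcont : Continuous fun x => ‖quadForm α β γ x‖ := (contDiff_quadForm (n := 0)).continuous.norm
  obtain ⟨x₀, hx₀, hmin⟩ := (isCompact_sphere (0 : ℝ × ℝ) 1).exists_isMinOn
    (NormedSpace.sphere_nonempty.2 zero_le_one) hcont.continuousOn
  have hx₀' : x₀ ≠ 0 := by rintro rfl; simp at hx₀
  refine ⟨_, norm_pos_iff.2 (Complex.slitPlane_ne_zero (h x₀ hx₀')), fun x => ?_⟩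
  rcases eq_or_ne x 0 with rfl | hx
  · simp
  have hn : ‖x‖ ≠ 0 := norm_ne_zero_iff.2 hx
  have hmem : ‖x‖⁻¹ • x ∈ Metric.sphere (0 : ℝ × ℝ) 1 := by simp [norm_smul, hn]
  have hx' : quadForm α β γ x = (‖x‖ : ℂ) ^ 2 * quadForm α β γ (‖x‖⁻¹ • x) := by
    have : (‖x‖ : ℂ) ≠ 0 := by exact_mod_cast hn
    simp only [quadForm, Prod.smul_fst, Prod.smul_snd, smul_eq_mul]
    push_cast
    field_simp
  have := hmin hmem
  simp only [Set.mem_ofPred_eq] at this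
  rw [hx', norm_mul, mul_comm]
  simp only [norm_pow, Complex.norm_real, norm_norm]
  gcongr

theorem norm_quadForm_le (x : ℝ × ℝ) :
    ‖quadForm α β γ x‖ ≤ (‖α‖ + ‖β‖ + ‖γ‖) * ‖x‖ ^ 2 := by
  have h1 : ‖(x.1 : ℂ)‖ ≤ ‖x‖ := by simpa using norm_fst_le x
  have h2 : ‖(x.2 : ℂ)‖ ≤ ‖x‖ := by simpa using norm_snd_le x
  calc _ ≤ ‖α * (x.1 : ℂ) ^ 2‖ + ‖β * ((x.1 : ℂ) * x.2)‖ + ‖γ * (x.2 : ℂ) ^ 2‖ := norm_add₃_le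
    _ = ‖α‖ * ‖(x.1 : ℂ)‖ ^ 2 + ‖β‖ * (‖(x.1 : ℂ)‖ * ‖(x.2 : ℂ)‖) + ‖γ‖ * ‖(x.2 : ℂ)‖ ^ 2 := by
      simp only [norm_mul, norm_pow]
    _ ≤ ‖α‖ * ‖x‖ ^ 2 + ‖β‖ * (‖x‖ * ‖x‖) + ‖γ‖ * ‖x‖ ^ 2 := by gcongr
    _ = _ := by ring

/-- From `log ‖z‖ = 2 log √‖z‖` and `|log u| ≤ u + u⁻¹`. The square root is taken because, for a
quadratic form, `√‖z‖` is comparable to `‖x‖`, which fits the common majorant. -/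
theorem norm_log_le (z : ℂ) (hz : z ≠ 0) : ‖Complex.log z‖ ≤ 2 * (√‖z‖ + (√‖z‖)⁻¹) + Real.pi := by
  have h0 : 0 < √‖z‖ := Real.sqrt_pos.2 (norm_pos_iff.2 hz)
  have h1 : |Real.log ‖z‖| ≤ 2 * (√‖z‖ + (√‖z‖)⁻¹) := by
    have e : Real.log ‖z‖ = 2 * Real.log (√‖z‖) := by
      rw [Real.log_sqrt (norm_nonneg z)]; ring
    have a1 := Real.log_le_sub_one_of_pos h0
    have a2 := Real.log_le_sub_one_of_pos (inv_pos.2 h0)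
    rw [Real.log_inv] at a2
    have := inv_pos.2 h0
    rw [e, abs_le]
    constructor <;> linarith
  calc _ ≤ |(Complex.log z).re| + |(Complex.log z).im| := Complex.norm_le_abs_re_add_abs_im _
    _ ≤ _ := by
      rw [Complex.log_re, Complex.log_im]
      exact add_le_add h1 (Complex.abs_arg_le_pi z)

theorem contDiffAt_log_quadForm (h : ∀ x, x ≠ 0 → quadForm α β γ x ∈ Complex.slitPlane)
    {x : ℝ × ℝ} (hx : x ≠ 0) {n : WithTop ℕ∞} :
    ContDiffAt ℝ n (fun x => Complex.log (quadForm α β γ x)) x :=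
  ((Complex.contDiffAt_log (h x hx)).restrict_scalars ℝ).comp x contDiff_quadForm.contDiffAt

theorem locallyIntegrable_log_quadForm (h : ∀ x, x ≠ 0 → quadForm α β γ x ∈ Complex.slitPlane) :
    LocallyIntegrable (fun x => Complex.log (quadForm α β γ x)) volume := by
  obtain ⟨κ, hκ, hle⟩ := exists_le_norm_quadForm h
  set M := ‖α‖ + ‖β‖ + ‖γ‖
  have hM : 0 ≤ M := by positivity
  refine locallyIntegrable_of_norm_le (C := 2 * (√M + (√κ)⁻¹) + Real.pi)
    (fun x hx => (contDiffAt_log_quadForm h hx (n := 0)).continuousAt.continuousWithinAt)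
    fun x hx => ?_
  have hn : 0 < ‖x‖ := norm_pos_iff.2 hx
  have hq := Complex.slitPlane_ne_zero (h x hx)
  have b1 : √‖quadForm α β γ x‖ ≤ √M * ‖x‖ := by
    have := Real.sqrt_le_sqrt (norm_quadForm_le (α := α) (β := β) (γ := γ) x)
    rwa [Real.sqrt_mul hM, Real.sqrt_sq hn.le] at this
  have b2 : (√‖quadForm α β γ x‖)⁻¹ ≤ (√κ)⁻¹ * ‖x‖⁻¹ := by
    have := Real.sqrt_le_sqrt (hle x)
    rw [Real.sqrt_mul hκ.le, Real.sqrt_sq hn.le] at this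
    rw [← mul_inv]
    have : 0 < √κ := Real.sqrt_pos.2 hκ
    gcongr
  -- Lets the constant `π` be absorbed into the majorant.
  have b3 : 1 ≤ ‖x‖ + ‖x‖⁻¹ := by
    rcases le_total 1 ‖x‖ with h1 | h1
    · have := inv_pos.2 hn; linarith
    · have := (one_le_inv₀ hn).2 h1; linarith
  have hi := inv_pos.2 hn
  have hk : 0 < (√κ)⁻¹ := inv_pos.2 (Real.sqrt_pos.2 hκ)
  calc _ ≤ 2 * (√‖quadForm α β γ x‖ + (√‖quadForm α β γ x‖)⁻¹) + Real.pi := norm_log_le _ hq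
    _ ≤ 2 * (√M * (‖x‖ + ‖x‖⁻¹) + (√κ)⁻¹ * (‖x‖ + ‖x‖⁻¹)) + Real.pi * (‖x‖ + ‖x‖⁻¹) := by
      gcongr
      · exact b1.trans (by gcongr; linarith)
      · exact b2.trans (by gcongr; linarith)
      · exact le_mul_of_one_le_right Real.pi_pos.le b3
    _ = _ := by ring

theorem continuousOn_linear_div_quadForm
    (h : ∀ x, x ≠ 0 → quadForm α β γ x ∈ Complex.slitPlane) (a b : ℂ) :
    ContinuousOn (fun x : ℝ × ℝ => (a * x.1 + b * x.2) / quadForm α β γ x) {0}ᶜ := by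
  refine ContinuousOn.div ?_ (contDiff_quadForm (n := 0)).continuous.continuousOn
    fun x hx => Complex.slitPlane_ne_zero (h x hx)
  fun_prop

theorem locallyIntegrable_linear_div_quadForm
    (h : ∀ x, x ≠ 0 → quadForm α β γ x ∈ Complex.slitPlane) (a b : ℂ) :
    LocallyIntegrable (fun x : ℝ × ℝ => (a * x.1 + b * x.2) / quadForm α β γ x) volume := by
  obtain ⟨κ, hκ, hle⟩ := exists_le_norm_quadForm h
  refine locallyIntegrable_of_norm_le (C := (‖a‖ + ‖b‖) / κ)
    (continuousOn_linear_div_quadForm h a b) fun x hx => ?_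
  have hn : 0 < ‖x‖ := norm_pos_iff.2 hx
  have h1 : ‖(x.1 : ℂ)‖ ≤ ‖x‖ := by simpa using norm_fst_le x
  have h2 : ‖(x.2 : ℂ)‖ ≤ ‖x‖ := by simpa using norm_snd_le x
  have h3 : ‖a * x.1 + b * x.2‖ ≤ (‖a‖ + ‖b‖) * ‖x‖ := by
    refine (norm_add_le _ _).trans ?_
    rw [norm_mul, norm_mul, add_mul]
    gcongr
  rw [norm_div]
  calc _ ≤ (‖a‖ + ‖b‖) * ‖x‖ / (κ * ‖x‖ ^ 2) := by
        gcongr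
        exact hle x
    _ = (‖a‖ + ‖b‖) / κ * ‖x‖⁻¹ := by field_simp
    _ ≤ _ := by gcongr; linarith

/-- Stated along an arbitrary curve, so that it covers both the coordinate lines of the weak
derivatives and the moving arms of the dipoles. -/
theorem hasDerivAt_log_quadForm (h : ∀ x, x ≠ 0 → quadForm α β γ x ∈ Complex.slitPlane)
    {l : ℝ → ℝ × ℝ} {v : ℝ × ℝ} {t : ℝ} (hl : HasDerivAt l v t) (hx : l t ≠ 0) :
    HasDerivAt (fun t => Complex.log (quadForm α β γ (l t)))
      ((v.1 * (2 * α * (l t).1 + β * (l t).2) + v.2 * (β * (l t).1 + 2 * γ * (l t).2)) /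
        quadForm α β γ (l t)) t := by
  have h1 : HasDerivAt (fun t => ((l t).1 : ℂ)) v.1 t :=
    HasDerivAt.ofReal_comp
      ((ContinuousLinearMap.fst ℝ ℝ ℝ).hasFDerivAt.comp_hasDerivAt t hl : HasDerivAt (fun t => (l t).1) v.1 t)
  have h2 : HasDerivAt (fun t => ((l t).2 : ℂ)) v.2 t :=
    HasDerivAt.ofReal_comp
      ((ContinuousLinearMap.snd ℝ ℝ ℝ).hasFDerivAt.comp_hasDerivAt t hl : HasDerivAt (fun t => (l t).2) v.2 t)
  have hq : HasDerivAt (fun t => quadForm α β γ (l t))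
      (v.1 * (2 * α * (l t).1 + β * (l t).2) + v.2 * (β * (l t).1 + 2 * γ * (l t).2)) t := by
    unfold quadForm
    refine HasDerivAt.congr_deriv ((((h1.pow 2).const_mul α).add
      ((h1.mul h2).const_mul β)).add ((h2.pow 2).const_mul γ)) ?_
    push_cast
    ring
  exact hq.clog_real (h _ hx)

end

/-! ### Flux of the radial field through the origin -/

section

/-- The imaginary part `2 (Re s)(Im s) x₂²` vanishes only if `x₂ = 0` or `s` is real, and then the
form is positive. -/
theorem quadForm_sq_mem_slitPlane {s : ℂ} (hs : 0 < s.re) :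
    ∀ x, x ≠ 0 → quadForm 1 0 (s ^ 2) x ∈ Complex.slitPlane := by
  rintro ⟨x, y⟩ hx
  have hre : (quadForm 1 0 (s ^ 2) (x, y)).re = x ^ 2 + (s.re ^ 2 - s.im ^ 2) * y ^ 2 := by
    simp [quadForm, pow_two]
  have him : (quadForm 1 0 (s ^ 2) (x, y)).im = 2 * (s.re * s.im) * y ^ 2 := by
    simp [quadForm, pow_two, -mul_eq_mul_right_iff]; ring
  rw [Complex.mem_slitPlane_iff, hre, him]
  by_cases hy : y = 0
  · left
    have : x ≠ 0 := fun h => hx (by simp [h, hy])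
    have := sq_pos_of_ne_zero this
    simpa [hy] using this
  · by_cases hi : s.im = 0
    · left
      have : 0 < s.re ^ 2 * y ^ 2 := by positivity
      rw [hi]
      nlinarith [sq_nonneg x]
    · right; positivity

/-- The primitive of `θ ↦ s / (cos² θ + s² sin² θ) - 1` is `2π`-periodic. -/
theorem integral_div_cos_sq_add {s : ℂ} (hs : 0 < s.re) :
    ∫ θ in (-Real.pi)..Real.pi, s / quadForm 1 0 (s ^ 2) (Real.cos θ, Real.sin θ) =
      2 * Real.pi := by
  have h1s : (1 : ℂ) + s ≠ 0 := fun h => by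
    have := congrArg Complex.re h
    simp at this; linarith
  -- The Cayley transform sends the right half plane to the unit disc. With `z = exp (iθ)` one has
  -- `cos² θ + s² sin² θ = ((1 + s)/2)² (1 + k z⁻²)(1 + k z²)`, and both factors `1 + k z^{±2}` stay
  -- in the slit plane.
  set k : ℂ := (1 - s) / (1 + s) with hk
  have hk1 : ‖k‖ < 1 := by
    rw [hk, norm_div, div_lt_one (norm_pos_iff.2 h1s), ← sq_lt_sq₀ (norm_nonneg _) (norm_nonneg _),
      ← Complex.normSq_eq_norm_sq, ← Complex.normSq_eq_norm_sq, Complex.normSq_apply,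
      Complex.normSq_apply]
    simp
    nlinarith
  let e : ℂ → ℝ → ℂ := fun c θ => Complex.exp (c * Complex.I * θ)
  have hslit : ∀ c : ℝ, ∀ θ, 1 + k * e c θ ∈ Complex.slitPlane := fun c θ => by
    refine Complex.mem_slitPlane_of_norm_lt_one ?_
    have : ‖e c θ‖ = 1 := by
      simp only [e]
      rw [show (c : ℂ) * Complex.I * θ = ((c * θ : ℝ) : ℂ) * Complex.I by push_cast; ring]
      exact Complex.norm_exp_ofReal_mul_I _
    rwa [norm_mul, this, mul_one]
  have hlog : ∀ c : ℝ, ∀ θ, HasDerivAt (fun θ => Complex.log (1 + k * e c θ))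
      (k * (c * Complex.I * e c θ) / (1 + k * e c θ)) θ := fun c θ => by
    have h1 : HasDerivAt (fun θ : ℝ => (c : ℂ) * Complex.I * θ) (c * Complex.I) θ := by
      simpa using (Complex.ofRealCLM.hasDerivAt (x := θ)).const_mul ((c : ℂ) * Complex.I)
    have h2 := ((h1.cexp.const_mul k).const_add 1).clog_real (hslit c θ)
    convert h2 using 1
    simp only [e]; ring
  -- The integrand is the Poisson-type kernel `(1 - k²) / ((1 + k z⁻²)(1 + k z²))`, integrated by
  -- partial fractions; only the term `θ` is not periodic.
  let F : ℝ → ℂ := fun θ => θ + 1 / (2 * Complex.I) *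
    (Complex.log (1 + k * e (-2 : ℝ) θ) - Complex.log (1 + k * e (2 : ℝ) θ))
  have hF : ∀ θ, HasDerivAt F (s / quadForm 1 0 (s ^ 2) (Real.cos θ, Real.sin θ)) θ := by
    intro θ
    have h0 : HasDerivAt (fun θ : ℝ => (θ : ℂ)) 1 θ := (hasDerivAt_id θ).ofReal_comp
    refine (h0.add (((hlog (-2) θ).sub (hlog 2 θ)).const_mul _)).congr_deriv ?_
    have n1 := Complex.slitPlane_ne_zero (hslit (-2) θ)
    have n2 := Complex.slitPlane_ne_zero (hslit 2 θ)
    set z : ℂ := Complex.exp (Complex.I * θ) with hz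
    have hz0 : z ≠ 0 := Complex.exp_ne_zero _
    have e1 : e (-2 : ℝ) θ = z⁻¹ ^ 2 := by
      simp only [e, hz]
      rw [← Complex.exp_neg, ← Complex.exp_nat_mul]
      congr 1; push_cast; ring
    have e2 : e (2 : ℝ) θ = z ^ 2 := by
      simp only [e, hz]
      rw [← Complex.exp_nat_mul]
      congr 1; push_cast; ring
    have hc : (Real.cos θ : ℂ) = (z + z⁻¹) / 2 := by
      rw [hz, ← Complex.exp_neg, Complex.ofReal_cos, Complex.cos]
      congr 2 <;> congr 1 <;> ring
    have hsn : (Real.sin θ : ℂ) = (z⁻¹ - z) * Complex.I / 2 := by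
      rw [hz, ← Complex.exp_neg, Complex.ofReal_sin, Complex.sin]
      congr 3 <;> congr 1 <;> ring
    have hq : quadForm 1 0 (s ^ 2) (Real.cos θ, Real.sin θ) =
        ((1 + s) / 2) ^ 2 * ((1 + k * z⁻¹ ^ 2) * (1 + k * z ^ 2)) := by
      simp only [quadForm]
      rw [hc, hsn, hk]
      field_simp
      rw [Complex.I_sq]
      ring
    rw [e1] at n1 ⊢
    rw [e2] at n2 ⊢
    rw [hq]
    have hs' : s = (1 + s) ^ 2 / 4 * (1 - k ^ 2) := by
      rw [hk]; field_simp; ring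
    have hfin : 1 + 1 / (2 * Complex.I) * (k * (((-2 : ℝ) : ℂ) * Complex.I * z⁻¹ ^ 2) /
        (1 + k * z⁻¹ ^ 2) - k * (((2 : ℝ) : ℂ) * Complex.I * z ^ 2) / (1 + k * z ^ 2)) =
        (1 - k ^ 2) / ((1 + k * z⁻¹ ^ 2) * (1 + k * z ^ 2)) := by
      have hI := Complex.I_ne_zero
      have n1' : z ^ 2 + k ≠ 0 := by
        intro h; apply n1; field_simp; rw [h, mul_zero]
      push_cast
      field_simp
      ring
    rw [hfin, div_eq_div_iff (mul_ne_zero n1 n2)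
      (mul_ne_zero (pow_ne_zero _ (div_ne_zero h1s two_ne_zero)) (mul_ne_zero n1 n2))]
    linear_combination -((1 + k * z⁻¹ ^ 2) * (1 + k * z ^ 2)) * hs'
  have hcont : Continuous fun θ : ℝ => s / quadForm 1 0 (s ^ 2) (Real.cos θ, Real.sin θ) := by
    refine continuous_const.div ((contDiff_quadForm (n := 0)).continuous.comp (by fun_prop)) ?_
    refine fun θ => Complex.slitPlane_ne_zero (quadForm_sq_mem_slitPlane hs _ fun h => ?_)
    have h1 := congrArg Prod.fst h
    have h2 := congrArg Prod.snd h
    have := Real.sin_sq_add_cos_sq θ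
    simp_all
  rw [intervalIntegral.integral_eq_sub_of_hasDerivAt (fun θ _ => hF θ)
    (hcont.intervalIntegrable _ _)]
  have per : ∀ c : ℝ, (c = 2 ∨ c = -2) → e c Real.pi = 1 ∧ e c (-Real.pi : ℝ) = 1 := by
    rintro c (rfl | rfl)
    · refine ⟨Complex.exp_eq_one_iff.2 ⟨1, ?_⟩, Complex.exp_eq_one_iff.2 ⟨-1, ?_⟩⟩ <;>
        push_cast <;> ring
    · refine ⟨Complex.exp_eq_one_iff.2 ⟨-1, ?_⟩, Complex.exp_eq_one_iff.2 ⟨1, ?_⟩⟩ <;>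
        push_cast <;> ring
  simp only [F, (per 2 (.inl rfl)).1, (per 2 (.inl rfl)).2, (per (-2) (.inr rfl)).1,
    (per (-2) (.inr rfl)).2]
  push_cast
  ring

/-- The radial field `s x / (x₁² + s² x₂²)` has divergence `2π δ`. -/
theorem integral_radial_flux {s : ℂ} (hs : 0 < s.re) {φ : ℝ × ℝ → ℝ} (hφ : ContDiff ℝ ∞ φ)
    (hc : HasCompactSupport φ) :
    ∫ x : ℝ × ℝ, s / quadForm 1 0 (s ^ 2) x * (x.1 * pd₁ φ x + x.2 * pd₂ φ x) =
      -(2 * Real.pi * φ (0, 0)) := by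
  let k : ℝ → ℂ := fun θ => s / quadForm 1 0 (s ^ 2) (Real.cos θ, Real.sin θ)
  let w : ℝ × ℝ → ℝ := fun p => Real.cos p.2 * pd₁ φ (p.1 * Real.cos p.2, p.1 * Real.sin p.2) +
    Real.sin p.2 * pd₂ φ (p.1 * Real.cos p.2, p.1 * Real.sin p.2)
  have hk : Continuous k := by
    refine continuous_const.div ((contDiff_quadForm (n := 0)).continuous.comp (by fun_prop)) ?_
    refine fun θ => Complex.slitPlane_ne_zero (quadForm_sq_mem_slitPlane hs _ fun h => ?_)
    have h1 := congrArg Prod.fst h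
    have h2 := congrArg Prod.snd h
    have := Real.sin_sq_add_cos_sq θ
    simp_all
  have hw : Continuous w := by
    have h1 := (contDiff_pd₁ hφ).continuous
    have h2 := (contDiff_pd₂ hφ).continuous
    fun_prop
  have hray : ∀ r θ, HasDerivAt (fun r => φ (r * Real.cos θ, r * Real.sin θ)) (w (r, θ)) r := by
    intro r θ
    have h1 : HasDerivAt (fun r : ℝ => ((r * Real.cos θ, r * Real.sin θ) : ℝ × ℝ))
        (Real.cos θ, Real.sin θ) r := by
      simpa using ((hasDerivAt_id r).mul_const (Real.cos θ)).prodMk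
        ((hasDerivAt_id r).mul_const (Real.sin θ))
    have h2 := ((hφ.differentiable (by simp))
      (r * Real.cos θ, r * Real.sin θ)).hasFDerivAt.comp_hasDerivAt r h1
    refine h2.congr_deriv ?_
    rw [show ((Real.cos θ, Real.sin θ) : ℝ × ℝ) = Real.cos θ • (1, 0) + Real.sin θ • (0, 1) by simp,
      map_add, map_smul, map_smul]
    rfl
  have hpolar : ∀ r θ : ℝ, r ^ 2 ≤ 2 * ‖((r * Real.cos θ, r * Real.sin θ) : ℝ × ℝ)‖ ^ 2 := by
    intro r θ
    set x : ℝ × ℝ := (r * Real.cos θ, r * Real.sin θ) with hx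
    have h1 : |r * Real.cos θ| ≤ ‖x‖ := norm_fst_le x
    have h2 : |r * Real.sin θ| ≤ ‖x‖ := norm_snd_le x
    have h3 := sq_le_sq' (by linarith [abs_nonneg (r * Real.cos θ), norm_nonneg x]) h1
    have h4 := sq_le_sq' (by linarith [abs_nonneg (r * Real.sin θ), norm_nonneg x]) h2
    rw [sq_abs] at h3 h4
    nlinarith [Real.sin_sq_add_cos_sq θ]
  obtain ⟨R, hR0, hR⟩ := hc.isCompact.isBounded.exists_pos_norm_lt
  have hφ0 : ∀ x : ℝ × ℝ, R ≤ ‖x‖ → x ∉ tsupport φ := fun x hx h => (hR x h).not_ge hx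
  -- The norm on the product is the sup norm, smaller than the Euclidean one by a factor of at most
  -- `√2`; the factor 2 absorbs it.
  have hfar : ∀ r θ : ℝ, 2 * R ≤ |r| → R ≤ ‖((r * Real.cos θ, r * Real.sin θ) : ℝ × ℝ)‖ := by
    intro r θ hr
    by_contra! hlt
    have := hpolar r θ
    have h1 := sq_le_sq' (by linarith [abs_nonneg r]) hr
    rw [sq_abs] at h1
    nlinarith [norm_nonneg ((r * Real.cos θ, r * Real.sin θ) : ℝ × ℝ)]
  have hw0 : ∀ r θ : ℝ, 2 * R ≤ |r| → w (r, θ) = 0 := by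
    intro r θ hr
    have hn := hφ0 _ (hfar r θ hr)
    have hz : fderiv ℝ φ (r * Real.cos θ, r * Real.sin θ) = 0 := by
      by_contra hne
      exact hn (support_fderiv_subset ℝ hne)
    simp [w, pd₁, pd₂, hz]
  rw [← integral_comp_polarCoord_symm]
  -- The Jacobian `r` and the factor `r` from `x · ∇φ = r ∂_r φ` cancel the degree `-2` of the
  -- kernel, leaving an angular factor times the radial derivative of `φ`.
  have e1 : ∀ p ∈ polarCoord.target, p.1 • (fun x : ℝ × ℝ => s / quadForm 1 0 (s ^ 2) x *
      ((x.1 : ℂ) * pd₁ φ x + x.2 * pd₂ φ x)) (polarCoord.symm p) = k p.2 * w p := by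
    rintro ⟨r, θ⟩ hp
    have hr : 0 < r := hp.1
    have hr' : (r : ℂ) ≠ 0 := by exact_mod_cast hr.ne'
    have hq : quadForm 1 0 (s ^ 2) (r * Real.cos θ, r * Real.sin θ) =
        (r : ℂ) ^ 2 * quadForm 1 0 (s ^ 2) (Real.cos θ, Real.sin θ) := by
      simp only [quadForm]; push_cast; ring
    have hq0 : quadForm 1 0 (s ^ 2) (Real.cos θ, Real.sin θ) ≠ 0 := by
      refine Complex.slitPlane_ne_zero (quadForm_sq_mem_slitPlane hs _ fun h => ?_)
      have h1 := congrArg Prod.fst h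
      have h2 := congrArg Prod.snd h
      have := Real.sin_sq_add_cos_sq θ
      simp_all
    simp only [polarCoord_symm_apply, Complex.real_smul, hq, k, w]
    push_cast
    field_simp
  rw [setIntegral_congr_fun polarCoord.open_target.measurableSet e1]
  have hint : IntegrableOn (fun p : ℝ × ℝ => k p.2 * w p)
      (Set.Ioi 0 ×ˢ Set.Ioo (-Real.pi) Real.pi) := by
    have h1 : IntegrableOn (fun p : ℝ × ℝ => k p.2 * w p)
        (Set.Icc 0 (2 * R) ×ˢ Set.Icc (-Real.pi) Real.pi) := by
      refine ContinuousOn.integrableOn_compact (isCompact_Icc.prod isCompact_Icc) ?_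
      have := Complex.continuous_ofReal.comp hw
      exact ((hk.comp continuous_snd).mul this).continuousOn
    refine h1.of_forall_sdiff_eq_zero (measurableSet_Ioi.prod measurableSet_Ioo) ?_
    rintro ⟨r, θ⟩ ⟨⟨hr, hθ⟩, hn⟩
    have hr' : 0 < r := hr
    have : 2 * R ≤ |r| := by
      rw [abs_of_pos hr']
      by_contra! h
      exact hn ⟨⟨hr'.le, h.le⟩, Set.Ioo_subset_Icc_self hθ⟩
    simp [hw0 r θ this]
  have htarget : polarCoord.target = Set.Ioi 0 ×ˢ Set.Ioo (-Real.pi) Real.pi := rfl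
  rw [htarget, Measure.volume_eq_prod, ← Measure.prod_restrict]
  rw [IntegrableOn, Measure.volume_eq_prod, ← Measure.prod_restrict] at hint
  rw [integral_prod_symm _ hint]
  -- Along every ray the radial derivative integrates to `-φ(0)`, whatever the angle.
  have inner : ∀ θ, ∫ r in Set.Ioi 0, k θ * (w (r, θ) : ℂ) = k θ * (-φ (0, 0) : ℝ) := by
    intro θ
    rw [integral_const_mul, integral_complex_ofReal]
    congr 2
    have hcs : HasCompactSupport fun r => φ (r * Real.cos θ, r * Real.sin θ) := by
      refine HasCompactSupport.intro (K := Set.Icc (-(2 * R)) (2 * R)) isCompact_Icc fun r hr => ?_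
      by_contra hne
      refine hφ0 _ (hfar r θ ?_) (subset_tsupport _ hne)
      by_contra! h
      exact hr (abs_le.1 h.le)
    have hcd : ContDiff ℝ 1 fun r : ℝ => φ (r * Real.cos θ, r * Real.sin θ) :=
      (hφ.of_le (by exact_mod_cast le_top)).comp (by fun_prop)
    have := hcs.integral_Ioi_deriv_eq hcd 0
    simp only [zero_mul] at this
    rw [← this]
    exact integral_congr_ae (.of_forall fun r => ((hray r θ).deriv).symm)
  simp only [inner]
  rw [integral_mul_const, ← integral_Ioc_eq_integral_Ioo, ← intervalIntegral.integral_of_le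
    (by linarith [Real.pi_pos]), integral_div_cos_sq_add hs]
  push_cast
  ring

end

/-! ### The characteristic roots -/

/-- `s`, `t` are the two roots of the characteristic equation of a cubic material with moduli
`a = λ + 2 μ`, `b = μ*` and `c = λ + μ*`, and `R = a b (t² - s²)`. -/
structure IsCharPair (a b c : ℝ) (R s t : ℂ) : Prop where
  a_pos : 0 < a
  b_pos : 0 < b
  R_ne : R ≠ 0
  s_re : 0 < s.re
  t_re : 0 < t.re
  mul_eq : s * t = 1
  diff : a * b * (t ^ 2 - s ^ 2) = R
  char_s : (a * s ^ 2 - b) * (a - b * s ^ 2) = c ^ 2 * s ^ 2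
  char_t : (a * t ^ 2 - b) * (a - b * t ^ 2) = c ^ 2 * t ^ 2
  conj_cases : (conj R = R ∧ conj s = s ∧ conj t = t) ∨ (conj R = -R ∧ conj s = t ∧ conj t = s)

theorem sqrt_sq (z : ℂ) : Complex.sqrt z ^ 2 = z := by
  exact Complex.cpow_ofNat_inv_pow z 2

theorem sqrt_re_pos {z : ℂ} (hz : z ∈ Complex.slitPlane) : 0 < (Complex.sqrt z).re := by
  rw [Complex.sqrt, Complex.cpow_inv_two_re, Real.sqrt_pos]
  have h1 : -‖z‖ ≤ z.re := (abs_le.1 (Complex.abs_re_le_norm z)).1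
  rcases Complex.mem_slitPlane_iff.1 hz with h | h
  · have := norm_nonneg z; linarith
  · have := (abs_lt.1 (Complex.abs_re_lt_norm.2 h)).1; linarith

theorem conj_sqrt {z : ℂ} (hz : z ∈ Complex.slitPlane) :
    conj (Complex.sqrt z) = Complex.sqrt (conj z) := by
  have h2 : conj (2⁻¹ : ℂ) = 2⁻¹ := by rw [map_inv₀, Complex.conj_ofNat]
  have h3 := Complex.conj_cpow z 2⁻¹ (Complex.mem_slitPlane_iff_arg.1 hz).1
  rw [h2] at h3
  rw [Complex.sqrt, Complex.sqrt, h3]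

theorem sqrt_ofReal {r : ℝ} (hr : 0 ≤ r) : Complex.sqrt (r : ℂ) = (√r : ℝ) := by
  rw [Complex.sqrt_of_nonneg (by exact_mod_cast hr), Complex.ofReal_re]

section
variable {lam mu mus : ℝ}

theorem qCoef_eq (lam mu mus : ℝ) :
    qCoef lam mu mus = pCoef lam mu mus ^ 2 - (2 * mus * (lam + 2 * mu)) ^ 2 := by
  simp only [qCoef, pCoef]; ring

theorem sq_s₁ (lam mu mus : ℝ) : s₁ lam mu mus ^ 2 =
    (-(pCoef lam mu mus : ℂ) - sqrtQ lam mu mus) / (2 * mus * (lam + 2 * mu)) := by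
  rw [s₁, mul_pow, div_pow, sqrt_sq, sqrt_sq]
  push_cast
  ring

theorem sq_s₂ (lam mu mus : ℝ) : s₂ lam mu mus ^ 2 =
    (-(pCoef lam mu mus : ℂ) + sqrtQ lam mu mus) / (2 * mus * (lam + 2 * mu)) := by
  rw [s₂, mul_pow, div_pow, sqrt_sq, sqrt_sq]
  push_cast
  ring

/-- The squares of the roots solve `a b T² + p T + a b = 0`, whose discriminant is `q`: their
product is 1 and their difference is `R / (a b)`. The roots are real for `q > 0` (`μ* < μ`) and
complex conjugate for `q < 0` (`μ* > μ`). -/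
theorem isCharPair (hmu : 0 < mu) (hlam : 0 < lam + mu) (hmus : 0 < mus) (hne : mus ≠ mu) :
    IsCharPair (lam + 2 * mu) mus (lam + mus) (sqrtQ lam mu mus) (s₁ lam mu mus)
      (s₂ lam mu mus) := by
  have ha : 0 < lam + 2 * mu := by linarith
  have hab : 0 < mus * (lam + 2 * mu) := mul_pos hmus ha
  set p := pCoef lam mu mus with hp
  set q := qCoef lam mu mus with hq
  set R := sqrtQ lam mu mus with hR
  have hR2 : R ^ 2 = q := sqrt_sq _
  have hq0 : q ≠ 0 := by
    rw [hq, qCoef]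
    have : mu - mus ≠ 0 := sub_ne_zero.2 hne.symm
    have : lam + mu + mus ≠ 0 := by positivity
    positivity
  have hR0 : R ≠ 0 := by
    intro h
    rw [h] at hR2
    apply hq0
    exact_mod_cast (by simpa using hR2.symm : (q : ℂ) = 0)
  have hqp : q = p ^ 2 - (2 * mus * (lam + 2 * mu)) ^ 2 := qCoef_eq _ _ _
  -- The sides differ by `4μμ* + 4μ(λ + μ)`. If `q > 0` then `|p| > 2ab`, and this bound leaves only
  -- `p < -2ab`, so `-p ± √q` are positive.
  have hell : -(2 * mus * (lam + 2 * mu)) < -p := by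
    rw [hp, pCoef]
    nlinarith [mul_pos hmu hlam, mul_pos hmu hmus]
  have hcases : (conj R = R ∧ (-(p : ℂ) - R) ∈ Complex.slitPlane ∧
      (-(p : ℂ) + R) ∈ Complex.slitPlane) ∨
      (conj R = -R ∧ (-(p : ℂ) - R) ∈ Complex.slitPlane ∧ (-(p : ℂ) + R) ∈ Complex.slitPlane) := by
    rcases lt_or_gt_of_ne hq0 with hneg | hpos
    · right
      have e : R = I * (√(-q) : ℝ) := by
        rw [hR, sqrtQ, ← hq, show (q : ℂ) = -((-q : ℝ) : ℂ) by push_cast; ring,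
          Complex.sqrt_neg_of_nonneg (by exact_mod_cast (neg_pos.2 hneg).le),
          sqrt_ofReal (neg_pos.2 hneg).le]
      have hs : 0 < √(-q) := Real.sqrt_pos.2 (neg_pos.2 hneg)
      refine ⟨by rw [e]; simp, ?_, ?_⟩ <;>
      · rw [e, Complex.mem_slitPlane_iff]
        right
        simpa using hs.ne'
    · left
      have e : R = (√q : ℝ) := sqrt_ofReal hpos.le
      have hs := Real.sqrt_nonneg q
      have hs2 := Real.sq_sqrt hpos.le
      have hpn : √q < -p := by
        have h2 : 0 < 2 * mus * (lam + 2 * mu) := by linarith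
        have h1 : 2 * mus * (lam + 2 * mu) < -p := by nlinarith
        nlinarith
      refine ⟨by rw [e]; simp, ?_, ?_⟩ <;>
      · rw [e, Complex.mem_slitPlane_iff]
        left
        simp
        linarith
  have hm : (-(p : ℂ) - R) ∈ Complex.slitPlane := by aesop
  have hpl : (-(p : ℂ) + R) ∈ Complex.slitPlane := by aesop
  have hD : 0 < 2 * mus * (lam + 2 * mu) := by linarith
  have hDs : 1 / Complex.sqrt ((2 * mus * (lam + 2 * mu) : ℝ) : ℂ) =
      ((1 / √(2 * mus * (lam + 2 * mu)) : ℝ) : ℂ) := by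
    rw [sqrt_ofReal hD.le]; push_cast; rfl
  have hD' : 0 < 1 / √(2 * mus * (lam + 2 * mu)) := by positivity
  have es₁ : s₁ lam mu mus = ((1 / √(2 * mus * (lam + 2 * mu)) : ℝ) : ℂ) *
      Complex.sqrt (-(p : ℂ) - R) := by rw [s₁, hDs]
  have es₂ : s₂ lam mu mus = ((1 / √(2 * mus * (lam + 2 * mu)) : ℝ) : ℂ) *
      Complex.sqrt (-(p : ℂ) + R) := by rw [s₂, hDs]
  have r₁ : 0 < (s₁ lam mu mus).re := by
    rw [es₁, Complex.re_ofReal_mul]; exact mul_pos hD' (sqrt_re_pos hm)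
  have r₂ : 0 < (s₂ lam mu mus).re := by
    rw [es₂, Complex.re_ofReal_mul]; exact mul_pos hD' (sqrt_re_pos hpl)
  have q₁ := sq_s₁ lam mu mus
  have q₂ := sq_s₂ lam mu mus
  rw [← hp, ← hR] at q₁ q₂
  have hb0 : (mus : ℂ) ≠ 0 := by exact_mod_cast hmus.ne'
  have ha0 : (lam : ℂ) + 2 * mu ≠ 0 := by exact_mod_cast ha.ne'
  have hqp' : R ^ 2 = (p : ℂ) ^ 2 - (2 * mus * (lam + 2 * mu)) ^ 2 := by
    rw [hR2, hqp]; push_cast; ring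
  have hpc : (p : ℂ) = 2 * lam * mus - 4 * mu * (lam + mu) := by rw [hp, pCoef]; push_cast; ring
  have hmul : s₁ lam mu mus * s₂ lam mu mus = 1 := by
    have h2 : (s₁ lam mu mus * s₂ lam mu mus) ^ 2 = 1 := by
      rw [mul_pow, q₁, q₂]
      field_simp
      linear_combination -hqp'
    -- The product -1 is excluded: `-1/s₂` has a negative real part when `s₂` has a positive one.
    rcases (sq_eq_sq_iff_eq_or_eq_neg.1 (h2.trans (one_pow 2).symm)) with h | h
    · exact h
    · exfalso
      have hn : s₁ lam mu mus = -(s₂ lam mu mus)⁻¹ := by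
        have : s₂ lam mu mus ≠ 0 := fun h0 => by simp [h0] at r₂
        field_simp
        exact h
      have := r₁
      rw [hn, Complex.neg_re, Complex.inv_re] at this
      have h3 : 0 ≤ (s₂ lam mu mus).re / Complex.normSq (s₂ lam mu mus) :=
        div_nonneg r₂.le (Complex.normSq_nonneg _)
      linarith
  -- Here `T` is the square of a root and `X = ∓√q`. The characteristic equation is the quadratic
  -- for `T` because `p = c² - a² - b²`.
  have hchar : ∀ T X : ℂ, 2 * mus * (lam + 2 * mu) * T = -p + X →
      X ^ 2 = (p : ℂ) ^ 2 - (2 * mus * (lam + 2 * mu)) ^ 2 →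
      (((lam + 2 * mu : ℝ) : ℂ) * T - mus) * (((lam + 2 * mu : ℝ) : ℂ) - mus * T) =
        ((lam + mus : ℝ) : ℂ) ^ 2 * T := by
    intro T X hT hX
    have h4 : (4 : ℂ) * (mus * (lam + 2 * mu)) ≠ 0 := mul_ne_zero (by norm_num) (mul_ne_zero hb0 ha0)
    have hquad : (mus : ℂ) * (lam + 2 * mu) * T ^ 2 + p * T + mus * (lam + 2 * mu) = 0 := by
      refine (mul_eq_zero.1 ?_).resolve_left h4
      linear_combination (2 * mus * (lam + 2 * mu) * T + p + X) * hT + hX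
    push_cast
    linear_combination -hquad + T * hpc
  refine ⟨ha, hmus, hR0, r₁, r₂, hmul, ?_, ?_, ?_, ?_⟩
  · rw [q₁, q₂]
    push_cast
    field_simp
    ring
  · exact hchar _ (-R) (by rw [q₁]; field_simp; ring) (by rw [neg_sq, hqp'])
  · exact hchar _ R (by rw [q₂]; field_simp) hqp'
  · rcases hcases with ⟨h, -, -⟩ | ⟨h, -, -⟩
    · left
      refine ⟨h, ?_, ?_⟩
      · rw [es₁, map_mul, Complex.conj_ofReal, conj_sqrt hm]
        simp [h]
      · rw [es₂, map_mul, Complex.conj_ofReal, conj_sqrt hpl]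
        simp [h]
    · right
      refine ⟨h, ?_, ?_⟩
      · rw [es₁, es₂, map_mul, Complex.conj_ofReal, conj_sqrt hm]
        simp [h]
      · rw [es₁, es₂, map_mul, Complex.conj_ofReal, conj_sqrt hpl]
        simp [h, sub_eq_add_neg]

end

section

/-! ### Smooth representations of the logarithmic and angular potentials -/

/-- `θ_t - θ_s`, written with the two forms `(x₁ ± i t x₂) (x₁ ∓ i s x₂)`, `s t = 1`. -/
noncomputable def angDiff (s t : ℂ) (x : ℝ × ℝ) : ℂ :=
  -I / 2 * (Complex.log (quadForm 1 (I * (t - s)) 1 x) -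
    Complex.log (quadForm 1 (-(I * (t - s))) 1 x))

/-- `log (x₁² + s² x₂²)`, twice the logarithm of `rad s`. -/
noncomputable def logSq (s : ℂ) (x : ℝ × ℝ) : ℂ := Complex.log (quadForm 1 0 (s ^ 2) x)

theorem quadForm_sq (s : ℂ) (x : ℝ × ℝ) :
    quadForm 1 0 (s ^ 2) x = (x.1 : ℂ) ^ 2 + s ^ 2 * (x.2 : ℂ) ^ 2 := by simp [quadForm]

theorem rad_sq (s : ℂ) (x : ℝ × ℝ) : rad s x ^ 2 = quadForm 1 0 (s ^ 2) x := by
  rw [rad, sqrt_sq, quadForm_sq]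

/-- Half of a principal argument is again a principal argument. At the origin both sides are 0 by
the default value of the logarithm. -/
theorem log_rad {s : ℂ} (hs : 0 < s.re) (x : ℝ × ℝ) :
    Complex.log (rad s x) = 1 / 2 * logSq s x := by
  rw [rad, logSq, ← quadForm_sq]
  rcases eq_or_ne x 0 with rfl | hx
  · simp [quadForm]
  · rw [sqrt_eq_exp (Complex.slitPlane_ne_zero (quadForm_sq_mem_slitPlane hs x hx)),
      Complex.log_exp]
    · ring
    · have := Complex.neg_pi_lt_arg (quadForm 1 0 (s ^ 2) x)
      rw [Complex.div_ofNat_im, Complex.log_im]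
      linarith [Real.pi_pos]
    · have := Complex.arg_le_pi (quadForm 1 0 (s ^ 2) x)
      rw [Complex.div_ofNat_im, Complex.log_im]
      linarith [Real.pi_pos]

theorem log_sub_log {z w : ℂ} (hz : z ≠ 0) (hw : w ≠ 0) (h : |z.arg - w.arg| < Real.pi) :
    Complex.log z - Complex.log w = Complex.log (z / w) := by
  obtain ⟨h1, h2⟩ := abs_lt.1 h
  rw [← Complex.log_exp (x := Complex.log z - Complex.log w), Complex.exp_sub, Complex.exp_log hz,
    Complex.exp_log hw]
  · simpa [Complex.log_im] using h1
  · simpa [Complex.log_im] using h2.le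

/-- The conformal map in the definition of the arctangent sends the right half plane to the upper
half plane. -/
theorem im_cayley_pos {z : ℂ} (hz : 0 < z.re) : 0 < ((1 + z * I) / (1 - z * I)).im := by
  have h0 : 1 - z * I ≠ 0 := fun h => by
    have := congrArg Complex.im h
    simp at this
    exact hz.ne' this
  have h1 : 0 < Complex.normSq (1 - z * I) := Complex.normSq_pos.2 h0
  rw [Complex.div_im, ← sub_div]
  refine div_pos ?_ h1
  simp
  nlinarith

theorem im_cayley_neg {z : ℂ} (hz : z.re < 0) : ((1 + z * I) / (1 - z * I)).im < 0 := by
  have h0 : 1 - z * I ≠ 0 := fun h => by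
    have := congrArg Complex.im h
    simp at this
    exact hz.ne this
  have h1 : 0 < Complex.normSq (1 - z * I) := Complex.normSq_pos.2 h0
  rw [Complex.div_im, ← sub_div]
  refine div_neg_of_neg_of_pos ?_ h1
  simp
  nlinarith

variable {a b c : ℝ} {R s t : ℂ}

/-- For conjugate roots `s t = 1` means `|s| = 1`, and `Re s > 0` makes `|Im s| < 1`. This bound
makes the real parts of the two forms in `angDiff` positive definite. -/
theorem IsCharPair.abs_im_lt (h : IsCharPair a b c R s t) : |(t - s).im| < 2 := by
  rcases h.conj_cases with ⟨-, h1, h2⟩ | ⟨-, h1, h2⟩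
  · rw [Complex.sub_im, Complex.conj_eq_iff_im.1 h1, Complex.conj_eq_iff_im.1 h2]
    simp
  · have hm := h.mul_eq
    rw [← h1, Complex.mul_conj] at hm
    have hn : Complex.normSq s = 1 := by exact_mod_cast hm
    rw [Complex.normSq_apply] at hn
    have := h.s_re
    rw [← h1, Complex.sub_im, Complex.conj_im, abs_lt]
    constructor <;> nlinarith

theorem IsCharPair.re_quadForm_pos (h : IsCharPair a b c R s t) {e : ℝ} (he : |e| ≤ 1)
    {x : ℝ × ℝ} (hx : x ≠ 0) : 0 < (quadForm 1 (e * (I * (t - s))) 1 x).re := by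
  obtain ⟨x, y⟩ := x
  have hre : (quadForm 1 (e * (I * (t - s))) 1 (x, y)).re =
      x ^ 2 - e * (t - s).im * (x * y) + y ^ 2 := by
    simp [quadForm, pow_two]
    ring
  have hk : |e * (t - s).im| < 2 := by
    rw [abs_mul]
    have := h.abs_im_lt
    nlinarith [abs_nonneg e, abs_nonneg (t - s).im]
  have hxy : 0 < x ^ 2 + y ^ 2 := by
    by_cases h0 : x = 0
    · have : y ≠ 0 := fun h1 => hx (by simp [h0, h1])
      positivity
    · positivity
  obtain ⟨h1, h2⟩ := abs_lt.1 hk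
  rw [hre]
  set k := e * (t - s).im
  rcases eq_or_ne (x - y) 0 with h0 | h0
  · have : 0 < (2 - k) * (x ^ 2 + y ^ 2) := mul_pos (by linarith) hxy
    rw [sub_eq_zero.1 h0] at this ⊢
    nlinarith
  -- Uses `4(x² - kxy + y²) = (2 + k)(x - y)² + (2 - k)(x + y)²`.
  · have p1 : 0 < (2 + k) * (x - y) ^ 2 := mul_pos (by linarith) (by positivity)
    have p2 : 0 ≤ (2 - k) * (x + y) ^ 2 := mul_nonneg (by linarith) (sq_nonneg _)
    nlinarith

theorem IsCharPair.slit_pos (h : IsCharPair a b c R s t) :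
    ∀ x, x ≠ 0 → quadForm 1 (I * (t - s)) 1 x ∈ Complex.slitPlane := fun x hx =>
  Complex.mem_slitPlane_iff.2 (.inl (by simpa using h.re_quadForm_pos (e := 1) (by simp) hx))

theorem IsCharPair.slit_neg (h : IsCharPair a b c R s t) :
    ∀ x, x ≠ 0 → quadForm 1 (-(I * (t - s))) 1 x ∈ Complex.slitPlane := fun x hx =>
  Complex.mem_slitPlane_iff.2 (.inl (by simpa using h.re_quadForm_pos (e := -1) (by simp) hx))

/-- The arctangent is `-i/2` times the logarithm of a Cayley transform. For `x₁, x₂ ≠ 0` both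
transforms lie in the same open half plane, and so do the two quadratic forms; in each pair the
arguments differ by less than `π`, so the logarithms combine into those of two quotients, which
agree by `s t = 1`. On the axes both sides vanish, so the convention at `x₁ = 0` agrees with a
function smooth off the origin. -/
theorem IsCharPair.ang_sub_ang (h : IsCharPair a b c R s t) (x : ℝ × ℝ) :
    ang t x - ang s x = angDiff s t x := by
  obtain ⟨x, y⟩ := x
  rcases eq_or_ne x 0 with rfl | hx
  · simp [ang, angDiff, quadForm]
  rcases eq_or_ne y 0 with rfl | hy
  · simp [ang, angDiff, quadForm]
  have hx' : (x : ℂ) ≠ 0 := by exact_mod_cast hx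
  have h0 : ((x, y) : ℝ × ℝ) ≠ 0 := fun h => hx (congrArg Prod.fst h)
  have hp := h.re_quadForm_pos (e := 1) (by simp) h0
  have hm := h.re_quadForm_pos (e := -1) (by simp) h0
  simp only [Complex.ofReal_one, Complex.ofReal_neg, one_mul, neg_mul] at hp hm
  set z : ℂ := s * y / x with hz
  set w : ℂ := t * y / x with hw
  have hzre : z.re = s.re * (y / x) := by
    rw [hz, show s * y / x = s * ((y / x : ℝ) : ℂ) by push_cast; ring, Complex.re_mul_ofReal]
  have hwre : w.re = t.re * (y / x) := by
    rw [hw, show t * y / x = t * ((y / x : ℝ) : ℂ) by push_cast; ring, Complex.re_mul_ofReal]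
  have hyx : y / x ≠ 0 := div_ne_zero hy hx
  have hs := h.s_re
  have ht := h.t_re
  set A := (1 + z * I) / (1 - z * I) with hA
  set B := (1 + w * I) / (1 - w * I) with hB
  have key : A ≠ 0 ∧ B ≠ 0 ∧ |B.arg - A.arg| < Real.pi := by
    rcases lt_or_gt_of_ne hyx with hneg | hpos
    · have hA' := im_cayley_neg (z := z) (by rw [hzre]; nlinarith)
      have hB' := im_cayley_neg (z := w) (by rw [hwre]; nlinarith)
      rw [← hA] at hA'
      rw [← hB] at hB'
      refine ⟨fun h => by simp [h] at hA', fun h => by simp [h] at hB', ?_⟩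
      have a1 := Complex.arg_neg_iff.2 hA'
      have b1 := Complex.arg_neg_iff.2 hB'
      have a2 := Complex.neg_pi_lt_arg A
      have b2 := Complex.neg_pi_lt_arg B
      rw [abs_lt]; constructor <;> linarith
    · have hA' := im_cayley_pos (z := z) (by rw [hzre]; positivity)
      have hB' := im_cayley_pos (z := w) (by rw [hwre]; positivity)
      rw [← hA] at hA'
      rw [← hB] at hB'
      refine ⟨fun h => by simp [h] at hA', fun h => by simp [h] at hB', ?_⟩
      have a1 := Complex.arg_nonneg_iff.2 hA'.le
      have b1 := Complex.arg_nonneg_iff.2 hB'.le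
      have a2 := Complex.arg_lt_pi_iff.2 (.inr hA'.ne')
      have b2 := Complex.arg_lt_pi_iff.2 (.inr hB'.ne')
      rw [abs_lt]; constructor <;> linarith
  obtain ⟨hA0, hB0, hAB⟩ := key
  have hp0 : quadForm 1 (I * (t - s)) 1 (x, y) ≠ 0 := fun h => by simp [h] at hp
  have hm0 : quadForm 1 (-(I * (t - s))) 1 (x, y) ≠ 0 := fun h => by simp [h] at hm
  have hQ : |(quadForm 1 (I * (t - s)) 1 (x, y)).arg -
      (quadForm 1 (-(I * (t - s))) 1 (x, y)).arg| < Real.pi := by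
    have p1 := abs_lt.1 (Complex.abs_arg_lt_pi_div_two_iff.2 (.inl hp))
    have p2 := abs_lt.1 (Complex.abs_arg_lt_pi_div_two_iff.2 (.inl hm))
    rw [abs_lt]; constructor <;> linarith
  have e1 : ang t (x, y) - ang s (x, y) = -I / 2 * (Complex.log B - Complex.log A) := by
    simp only [ang, Complex.arctan, ← hz, ← hw, ← hA, ← hB]
    ring
  rw [e1, angDiff, log_sub_log hB0 hA0 hAB, log_sub_log hp0 hm0 hQ]
  congr 2
  have n1 : 1 + z * I ≠ 0 := fun h => hA0 (by rw [hA, h, zero_div])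
  have n2 : 1 - z * I ≠ 0 := fun h => hA0 (by rw [hA, h, div_zero])
  have n3 : 1 - w * I ≠ 0 := fun h => hB0 (by rw [hB, h, div_zero])
  have f1 : quadForm 1 (I * (t - s)) 1 (x, y) = (x : ℂ) ^ 2 * ((1 + w * I) * (1 - z * I)) := by
    simp only [quadForm, hz, hw]
    field_simp
    linear_combination (y : ℂ) ^ 2 * Complex.I_sq * s * t - (y : ℂ) ^ 2 * h.mul_eq
  have f2 : quadForm 1 (-(I * (t - s))) 1 (x, y) =
      (x : ℂ) ^ 2 * ((1 - w * I) * (1 + z * I)) := by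
    simp only [quadForm, hz, hw]
    field_simp
    linear_combination (y : ℂ) ^ 2 * Complex.I_sq * s * t - (y : ℂ) ^ 2 * h.mul_eq
  rw [f1, f2, hA, hB]
  field_simp

/-! ### Derivatives of the potentials -/

theorem contDiffAt_logSq (hs : 0 < s.re) {x : ℝ × ℝ} (hx : x ≠ 0) {n : WithTop ℕ∞} :
    ContDiffAt ℝ n (logSq s) x := contDiffAt_log_quadForm (quadForm_sq_mem_slitPlane hs) hx

theorem locallyIntegrable_logSq (hs : 0 < s.re) : LocallyIntegrable (logSq s) volume :=
  locallyIntegrable_log_quadForm (quadForm_sq_mem_slitPlane hs)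

theorem hasDerivAt_logSq (hs : 0 < s.re) {l : ℝ → ℝ × ℝ} {v : ℝ × ℝ} {τ : ℝ}
    (hl : HasDerivAt l v τ) (hx : l τ ≠ 0) :
    HasDerivAt (fun τ => logSq s (l τ)) (2 * ((v.1 * (l τ).1 + v.2 * (s ^ 2 * (l τ).2)) /
      quadForm 1 0 (s ^ 2) (l τ))) τ :=
  (hasDerivAt_log_quadForm (quadForm_sq_mem_slitPlane hs) hl hx).congr_deriv (by ring)

theorem IsCharPair.contDiffAt_angDiff (h : IsCharPair a b c R s t) {x : ℝ × ℝ} (hx : x ≠ 0)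
    {n : WithTop ℕ∞} : ContDiffAt ℝ n (angDiff s t) x :=
  contDiffAt_const.mul ((contDiffAt_log_quadForm h.slit_pos hx).sub
    (contDiffAt_log_quadForm h.slit_neg hx))

theorem IsCharPair.locallyIntegrable_angDiff (h : IsCharPair a b c R s t) :
    LocallyIntegrable (angDiff s t) volume :=
  ((locallyIntegrable_log_quadForm h.slit_pos).sub
    (locallyIntegrable_log_quadForm h.slit_neg)).smul (-I / 2)

theorem IsCharPair.hasDerivAt_angDiff (h : IsCharPair a b c R s t) {l : ℝ → ℝ × ℝ} {v : ℝ × ℝ}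
    {τ : ℝ} (hl : HasDerivAt l v τ) (hx : l τ ≠ 0) :
    HasDerivAt (fun τ => angDiff s t (l τ))
      ((v.2 * (l τ).1 - v.1 * (l τ).2) * (t / quadForm 1 0 (t ^ 2) (l τ) -
        s / quadForm 1 0 (s ^ 2) (l τ))) τ := by
  refine (((hasDerivAt_log_quadForm h.slit_pos hl hx).sub
    (hasDerivAt_log_quadForm h.slit_neg hl hx)).const_mul (-I / 2)).congr_deriv ?_
  have n1 := Complex.slitPlane_ne_zero (h.slit_pos _ hx)
  have n2 := Complex.slitPlane_ne_zero (h.slit_neg _ hx)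
  have n3 := Complex.slitPlane_ne_zero (quadForm_sq_mem_slitPlane h.s_re _ hx)
  have n4 := Complex.slitPlane_ne_zero (quadForm_sq_mem_slitPlane h.t_re _ hx)
  -- Both sides are the product of the four linear factors `x₁ ± i t x₂`, `x₁ ± i s x₂`, grouped
  -- differently.
  have hprod : quadForm 1 (I * (t - s)) 1 (l τ) * quadForm 1 (-(I * (t - s))) 1 (l τ) =
      quadForm 1 0 (t ^ 2) (l τ) * quadForm 1 0 (s ^ 2) (l τ) := by
    simp only [quadForm]
    linear_combination (-(t - s) ^ 2 * ((l τ).1 : ℂ) ^ 2 * ((l τ).2 : ℂ) ^ 2) * Complex.I_sq +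
      (-(s * t + 1) * ((l τ).2 : ℂ) ^ 4 - 2 * ((l τ).1 : ℂ) ^ 2 * ((l τ).2 : ℂ) ^ 2) * h.mul_eq
  rw [div_sub_div _ _ n1 n2, div_sub_div _ _ n4 n3, hprod, ← mul_div_assoc, ← mul_div_assoc]
  congr 1
  simp only [quadForm]
  linear_combination (-(t - s) * (v.2 * ((l τ).1 : ℂ) - v.1 * ((l τ).2 : ℂ)) *
    (((l τ).1 : ℂ) ^ 2 - ((l τ).2 : ℂ) ^ 2)) * Complex.I_sq +
    ((v.2 * ((l τ).1 : ℂ) - v.1 * ((l τ).2 : ℂ)) * (t - s) * ((l τ).2 : ℂ) ^ 2) * h.mul_eq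

end

section

variable {a b c : ℝ} {R s t : ℂ}

/-! ### Fields spanned by the three potentials -/

/-- The general combination of the potentials `log r_s`, `log r_t` and `θ_t - θ_s`. -/
noncomputable def potential (s t A B C : ℂ) (x : ℝ × ℝ) : ℂ :=
  A * logSq s x + B * logSq t x + C * angDiff s t x

/-- The derivative of `potential s t A B C` in the direction `v`. -/
noncomputable def gradPotential (s t A B C : ℂ) (v x : ℝ × ℝ) : ℂ :=
  ((2 * A * v.1 - C * s * v.2) * x.1 + (2 * A * s ^ 2 * v.2 + C * s * v.1) * x.2) /
      quadForm 1 0 (s ^ 2) x +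
    ((2 * B * v.1 + C * t * v.2) * x.1 + (2 * B * t ^ 2 * v.2 - C * t * v.1) * x.2) /
      quadForm 1 0 (t ^ 2) x

theorem IsCharPair.contDiffAt_potential (h : IsCharPair a b c R s t) (A B C : ℂ) {x : ℝ × ℝ}
    (hx : x ≠ 0) {n : WithTop ℕ∞} : ContDiffAt ℝ n (potential s t A B C) x :=
  ((contDiffAt_const.mul (contDiffAt_logSq h.s_re hx)).add
    (contDiffAt_const.mul (contDiffAt_logSq h.t_re hx))).add
    (contDiffAt_const.mul (h.contDiffAt_angDiff hx))

theorem IsCharPair.locallyIntegrable_potential (h : IsCharPair a b c R s t) (A B C : ℂ) :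
    LocallyIntegrable (potential s t A B C) volume :=
  (((locallyIntegrable_logSq h.s_re).smul A).add ((locallyIntegrable_logSq h.t_re).smul B)).add
    (h.locallyIntegrable_angDiff.smul C)

theorem IsCharPair.continuousOn_gradPotential (h : IsCharPair a b c R s t) (A B C : ℂ)
    (v : ℝ × ℝ) : ContinuousOn (gradPotential s t A B C v) {0}ᶜ :=
  (continuousOn_linear_div_quadForm (quadForm_sq_mem_slitPlane h.s_re) _ _).add
    (continuousOn_linear_div_quadForm (quadForm_sq_mem_slitPlane h.t_re) _ _)

theorem IsCharPair.locallyIntegrable_gradPotential (h : IsCharPair a b c R s t) (A B C : ℂ)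
    (v : ℝ × ℝ) : LocallyIntegrable (gradPotential s t A B C v) volume :=
  (locallyIntegrable_linear_div_quadForm (quadForm_sq_mem_slitPlane h.s_re) _ _).add
    (locallyIntegrable_linear_div_quadForm (quadForm_sq_mem_slitPlane h.t_re) _ _)

theorem IsCharPair.hasDerivAt_potential (h : IsCharPair a b c R s t) (A B C : ℂ)
    {l : ℝ → ℝ × ℝ} {v : ℝ × ℝ} {τ : ℝ} (hl : HasDerivAt l v τ) (hx : l τ ≠ 0) :
    HasDerivAt (fun τ => potential s t A B C (l τ)) (gradPotential s t A B C v (l τ)) τ := by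
  refine ((((hasDerivAt_logSq h.s_re hl hx).const_mul A).add
    ((hasDerivAt_logSq h.t_re hl hx).const_mul B)).add
    ((h.hasDerivAt_angDiff hl hx).const_mul C)).congr_deriv ?_
  simp only [gradPotential]
  ring

section

theorem integrable_linear {F G : ℝ × ℝ → ℂ} (hF : Integrable F) (hG : Integrable G) (k l : ℂ) :
    Integrable fun x => k * F x + l * G x := (hF.const_mul k).add (hG.const_mul l)

theorem integral_linear {F G : ℝ × ℝ → ℂ} (hF : Integrable F) (hG : Integrable G) (k l : ℂ) :
    ∫ x, (k * F x + l * G x) = k * (∫ x, F x) + l * ∫ x, G x := by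
  rw [integral_add (hF.const_mul k) (hG.const_mul l), integral_const_mul, integral_const_mul]

variable {φ : ℝ × ℝ → ℝ}

theorem IsCharPair.integral_pd₁_potential (h : IsCharPair a b c R s t) (A B C : ℂ)
    (hφ : ContDiff ℝ ∞ φ) (hc : HasCompactSupport φ) :
    ∫ x, (pd₁ φ x : ℂ) * potential s t A B C x =
      -∫ x, (φ x : ℂ) * gradPotential s t A B C (1, 0) x :=
  integral_pd₁_mul (h.locallyIntegrable_potential A B C) (h.locallyIntegrable_gradPotential A B C _)
    (h.continuousOn_gradPotential A B C _) (fun x hx =>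
      h.hasDerivAt_potential A B C (l := fun τ => (τ, x.2))
        ((hasDerivAt_id x.1).prodMk (hasDerivAt_const x.1 x.2)) hx) hφ hc

theorem IsCharPair.integral_pd₂_potential (h : IsCharPair a b c R s t) (A B C : ℂ)
    (hφ : ContDiff ℝ ∞ φ) (hc : HasCompactSupport φ) :
    ∫ x, (pd₂ φ x : ℂ) * potential s t A B C x =
      -∫ x, (φ x : ℂ) * gradPotential s t A B C (0, 1) x :=
  integral_pd₂_mul (h.locallyIntegrable_potential A B C) (h.locallyIntegrable_gradPotential A B C _)
    (h.continuousOn_gradPotential A B C _) (fun x hx =>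
      h.hasDerivAt_potential A B C (l := fun τ => (x.1, τ))
        ((hasDerivAt_const x.2 x.1).prodMk (hasDerivAt_id x.2)) hx) hφ hc

/-- The pairings of a combination of potentials with the second derivatives of a test function,
reduced to four numbers attached to the test function. -/
theorem IsCharPair.exists_pairings (h : IsCharPair a b c R s t)
    (hφ : ContDiff ℝ ∞ φ) (hc : HasCompactSupport φ) :
    ∃ βs βt γs γt : ℂ, ∀ A B C : ℂ,
      ∫ x, (pd₁ (pd₁ φ) x : ℂ) * potential s t A B C x =
        2 * A * (2 * Real.pi * φ (0, 0) / s + βs) + 2 * B * (2 * Real.pi * φ (0, 0) / t + βt) +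
          C * (t * γt - s * γs) ∧
      ∫ x, (pd₂ (pd₂ φ) x : ℂ) * potential s t A B C x =
        -(2 * A * s ^ 2 * βs) - 2 * B * t ^ 2 * βt + C * (s ^ 3 * γs - t ^ 3 * γt) ∧
      ∫ x, (pd₁ (pd₂ φ) x : ℂ) * potential s t A B C x =
        -(2 * A * s ^ 2 * γs) - 2 * B * t ^ 2 * γt + C * (t * βt - s * βs) := by
  have hs0 : s ≠ 0 := fun h0 => by simpa [h0] using h.s_re
  have ht0 : t ≠ 0 := fun h0 => by simpa [h0] using h.t_re
  have hφ1 := contDiff_pd₁ hφ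
  have hφ2 := contDiff_pd₂ hφ
  have hc1 := hasCompactSupport_pd₁ hc
  have hc2 := hasCompactSupport_pd₂ hc
  let T : (ℝ × ℝ → ℝ) → (ℝ × ℝ → ℂ) → ℂ := fun ψ f => ∫ x, (ψ x : ℂ) * f x
  -- The trivial coefficients in `E` and `N` match the shape of
  -- `locallyIntegrable_linear_div_quadForm`.
  let E : ℂ → ℝ × ℝ → ℂ := fun s x => (1 * x.1 + 0 * x.2) / quadForm 1 0 (s ^ 2) x
  let N : ℂ → ℝ × ℝ → ℂ := fun s x => (0 * x.1 + 1 * x.2) / quadForm 1 0 (s ^ 2) x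
  have hE : ∀ {s : ℂ}, 0 < s.re → LocallyIntegrable (E s) volume := fun hs =>
    locallyIntegrable_linear_div_quadForm (quadForm_sq_mem_slitPlane hs) 1 0
  have hN : ∀ {s : ℂ}, 0 < s.re → LocallyIntegrable (N s) volume := fun hs =>
    locallyIntegrable_linear_div_quadForm (quadForm_sq_mem_slitPlane hs) 0 1
  have hgrad : ∀ (ψ : ℝ × ℝ → ℝ), Continuous ψ → HasCompactSupport ψ → ∀ (A B C : ℂ) (v : ℝ × ℝ),
      ∫ x, (ψ x : ℂ) * gradPotential s t A B C v x =
        (2 * A * v.1 - C * s * v.2) * T ψ (E s) + (2 * A * s ^ 2 * v.2 + C * s * v.1) * T ψ (N s) +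
        ((2 * B * v.1 + C * t * v.2) * T ψ (E t) +
          (2 * B * t ^ 2 * v.2 - C * t * v.1) * T ψ (N t)) := by
    intro ψ hψ hψc A B C v
    have i1 := integrable_test_mul (hE h.s_re) hψ hψc
    have i2 := integrable_test_mul (hN h.s_re) hψ hψc
    have i3 := integrable_test_mul (hE h.t_re) hψ hψc
    have i4 := integrable_test_mul (hN h.t_re) hψ hψc
    simp only [T]
    rw [← integral_linear i1 i2, ← integral_linear i3 i4,
      ← integral_add (integrable_linear i1 i2 _ _) (integrable_linear i3 i4 _ _)]
    congr 1
    funext x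
    simp only [gradPotential, E, N]
    ring
  -- The only place where the delta at the origin enters.
  have hflux : ∀ {s : ℂ}, 0 < s.re → s ≠ 0 →
      T (pd₁ φ) (E s) = -(2 * Real.pi * φ (0, 0) / s + T (pd₂ φ) (N s)) := by
    intro s hs hs0
    have i1 := integrable_test_mul (hE hs) hφ1.continuous hc1
    have i2 := integrable_test_mul (hN hs) hφ2.continuous hc2
    have h1 : s * (T (pd₁ φ) (E s) + T (pd₂ φ) (N s)) = -(2 * Real.pi * φ (0, 0)) := by
      rw [← integral_radial_flux hs hφ hc]
      simp only [T]
      rw [← integral_add i1 i2, ← integral_const_mul]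
      congr 1
      funext x
      simp only [E, N]
      ring
    field_simp
    linear_combination h1
  -- symmetry of the second derivatives, tested on a single logarithm
  have hsymm := fun A B C : ℂ =>
    ((h.integral_pd₁_potential A B C hφ2 hc2).symm.trans
      ((by rw [pd₁_pd₂_comm hφ] : _ = _).trans (h.integral_pd₂_potential A B C hφ1 hc1)))
  have hsE : T (pd₂ φ) (E s) = s ^ 2 * T (pd₁ φ) (N s) := by
    have := hsymm (1 / 2) 0 0
    rw [hgrad _ hφ2.continuous hc2, hgrad _ hφ1.continuous hc1] at this
    push_cast at this
    linear_combination -this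
  have htE : T (pd₂ φ) (E t) = t ^ 2 * T (pd₁ φ) (N t) := by
    have := hsymm 0 (1 / 2) 0
    rw [hgrad _ hφ2.continuous hc2, hgrad _ hφ1.continuous hc1] at this
    push_cast at this
    linear_combination -this
  -- There are eight pairings of `∂₁φ`, `∂₂φ` with `E`, `N` at the two roots. The flux and the
  -- symmetry give one relation each per root, leaving four.
  refine ⟨T (pd₂ φ) (N s), T (pd₂ φ) (N t), T (pd₁ φ) (N s), T (pd₁ φ) (N t), fun A B C => ?_⟩
  refine ⟨?_, ?_, ?_⟩
  · rw [h.integral_pd₁_potential A B C hφ1 hc1, hgrad _ hφ1.continuous hc1, hflux h.s_re hs0,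
      hflux h.t_re ht0]
    push_cast
    ring
  · rw [h.integral_pd₂_potential A B C hφ2 hc2, hgrad _ hφ2.continuous hc2, hsE, htE]
    push_cast
    ring
  · rw [h.integral_pd₁_potential A B C hφ2 hc2, hgrad _ hφ2.continuous hc2, hsE, htE]
    push_cast
    ring

end

theorem locallyIntegrable_prodMk {u₁ u₂ : ℝ × ℝ → ℂ} (h₁ : LocallyIntegrable u₁ volume)
    (h₂ : LocallyIntegrable u₂ volume) : LocallyIntegrable (fun x => (u₁ x, u₂ x)) volume := by
  rw [locallyIntegrable_iff] at *
  exact fun K hK => (h₁ K hK).prodMk (h₂ K hK)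

theorem integral_test_combination {u₁ u₂ : ℝ × ℝ → ℂ} (h₁ : LocallyIntegrable u₁ volume)
    (h₂ : LocallyIntegrable u₂ volume) {ψ₁ ψ₂ ψ₃ : ℝ × ℝ → ℝ}
    (hψ₁ : Continuous ψ₁) (hψ₂ : Continuous ψ₂) (hψ₃ : Continuous ψ₃) (hc₁ : HasCompactSupport ψ₁)
    (hc₂ : HasCompactSupport ψ₂) (hc₃ : HasCompactSupport ψ₃) (k₁ k₂ k₃ : ℝ) :
    ∫ x, (((k₁ * ψ₁ x + k₂ * ψ₂ x : ℝ) : ℂ) * u₁ x + ((k₃ * ψ₃ x : ℝ) : ℂ) * u₂ x) =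
      k₁ * (∫ x, (ψ₁ x : ℂ) * u₁ x) + k₂ * (∫ x, (ψ₂ x : ℂ) * u₁ x) +
        k₃ * ∫ x, (ψ₃ x : ℂ) * u₂ x := by
  have i1 := integrable_test_mul h₁ hψ₁ hc₁
  have i2 := integrable_test_mul h₁ hψ₂ hc₂
  have i3 := integrable_test_mul h₂ hψ₃ hc₃
  rw [← integral_linear i1 i2, ← integral_const_mul,
    ← integral_add (integrable_linear i1 i2 _ _) (i3.const_mul _)]
  congr 1
  funext x
  push_cast
  ring

end

/-! ### The concentrated force -/

section
variable {lam mu mus : ℝ} {R s t : ℂ}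

/-- First displacement component of the concentrated force `P`. -/
noncomputable def forcePotential₁ (lam mu mus : ℝ) (R s t : ℂ) (P : ℝ × ℝ) : ℝ × ℝ → ℂ :=
  potential s t (P.1 / (4 * Real.pi * R) * Y1 lam mu mus s)
    (-(P.1 / (4 * Real.pi * R) * Y1 lam mu mus t)) (P.2 * (lam + mus) / (2 * Real.pi * R))

/-- Second displacement component of the concentrated force `P`. -/
noncomputable def forcePotential₂ (lam mu mus : ℝ) (R s t : ℂ) (P : ℝ × ℝ) : ℝ × ℝ → ℂ :=
  potential s t (P.2 / (4 * Real.pi * R) * Y2 lam mu mus s)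
    (-(P.2 / (4 * Real.pi * R) * Y2 lam mu mus t)) (P.1 * (lam + mus) / (2 * Real.pi * R))

/-- Derivative of `forcePotential₁` in the direction `v`. -/
noncomputable def gradForce₁ (lam mu mus : ℝ) (R s t : ℂ) (P v : ℝ × ℝ) : ℝ × ℝ → ℂ :=
  gradPotential s t (P.1 / (4 * Real.pi * R) * Y1 lam mu mus s)
    (-(P.1 / (4 * Real.pi * R) * Y1 lam mu mus t)) (P.2 * (lam + mus) / (2 * Real.pi * R)) v

/-- Derivative of `forcePotential₂` in the direction `v`. -/
noncomputable def gradForce₂ (lam mu mus : ℝ) (R s t : ℂ) (P v : ℝ × ℝ) : ℝ × ℝ → ℂ :=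
  gradPotential s t (P.2 / (4 * Real.pi * R) * Y2 lam mu mus s)
    (-(P.2 / (4 * Real.pi * R) * Y2 lam mu mus t)) (P.1 * (lam + mus) / (2 * Real.pi * R)) v

theorem pointForce_eq
    (h : IsCharPair (lam + 2 * mu) mus (lam + mus) (sqrtQ lam mu mus) (s₁ lam mu mus)
      (s₂ lam mu mus)) (P : ℝ × ℝ) :
    pointForce lam mu mus P = fun x =>
      (forcePotential₁ lam mu mus (sqrtQ lam mu mus) (s₁ lam mu mus) (s₂ lam mu mus) P x,
        forcePotential₂ lam mu mus (sqrtQ lam mu mus) (s₁ lam mu mus) (s₂ lam mu mus) P x) := by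
  funext x
  simp only [pointForce, forcePotential₁, forcePotential₂, potential, log_rad h.s_re,
    log_rad h.t_re, h.ang_sub_ang]
  ext1 <;> ring

/-- Weak form of the equilibrium equations for the concentrated force. -/
theorem IsCharPair.weak_force (h : IsCharPair (lam + 2 * mu) mus (lam + mus) R s t) (P : ℝ × ℝ)
    {φ : ℝ × ℝ → ℝ} (hφ : ContDiff ℝ ∞ φ) (hc : HasCompactSupport φ) :
    ((lam + 2 * mu : ℝ) : ℂ) * (∫ x, (pd₁ (pd₁ φ) x : ℂ) * forcePotential₁ lam mu mus R s t P x) +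
        mus * (∫ x, (pd₂ (pd₂ φ) x : ℂ) * forcePotential₁ lam mu mus R s t P x) +
        ((lam + mus : ℝ) : ℂ) *
          (∫ x, (pd₁ (pd₂ φ) x : ℂ) * forcePotential₂ lam mu mus R s t P x) =
      -(P.1 * φ (0, 0)) ∧
    ((lam + 2 * mu : ℝ) : ℂ) * (∫ x, (pd₂ (pd₂ φ) x : ℂ) * forcePotential₂ lam mu mus R s t P x) +
        mus * (∫ x, (pd₁ (pd₁ φ) x : ℂ) * forcePotential₂ lam mu mus R s t P x) +
        ((lam + mus : ℝ) : ℂ) *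
          (∫ x, (pd₁ (pd₂ φ) x : ℂ) * forcePotential₁ lam mu mus R s t P x) =
      -(P.2 * φ (0, 0)) := by
  obtain ⟨βs, βt, γs, γt, hp⟩ := h.exists_pairings hφ hc
  have hs0 : s ≠ 0 := fun h0 => by simpa [h0] using h.s_re
  have ht0 : t ≠ 0 := fun h0 => by simpa [h0] using h.t_re
  have hR := h.R_ne
  have hpi : (Real.pi : ℂ) ≠ 0 := by exact_mod_cast Real.pi_ne_zero
  have hst := h.mul_eq
  have hd := h.diff
  have es := h.char_s
  have et := h.char_t
  simp only [forcePotential₁, forcePotential₂]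
  rw [(hp _ _ _).1, (hp _ _ _).2.1, (hp _ _ _).2.2, (hp _ _ _).1, (hp _ _ _).2.1, (hp _ _ _).2.2]
  push_cast at *
  set a : ℂ := (lam : ℂ) + 2 * mu with ha
  set b : ℂ := (mus : ℂ) with hb
  set c : ℂ := (lam : ℂ) + mus with hcc
  set F : ℂ := (φ (0, 0) : ℂ)
  have y1 : ∀ {σ : ℂ}, σ ≠ 0 → Y1 lam mu mus σ * σ = a * σ ^ 2 - b := fun hσ => by
    rw [Y1, div_mul_cancel₀ _ hσ]
  have y2 : ∀ {σ : ℂ}, σ ≠ 0 → Y2 lam mu mus σ * σ = b * σ ^ 2 - a := fun hσ => by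
    rw [Y2, div_mul_cancel₀ _ hσ]
  -- the cancellations, for each root
  have k1 : ∀ {σ : ℂ}, σ ≠ 0 → (a * σ ^ 2 - b) * (a - b * σ ^ 2) = c ^ 2 * σ ^ 2 →
      Y1 lam mu mus σ * (a - b * σ ^ 2) = c ^ 2 * σ := fun {σ} hσ e => by
    refine mul_left_cancel₀ hσ ?_
    linear_combination (a - b * σ ^ 2) * y1 hσ + e
  have k2 : ∀ {σ : ℂ}, σ ≠ 0 → (a * σ ^ 2 - b) * (a - b * σ ^ 2) = c ^ 2 * σ ^ 2 →
      Y2 lam mu mus σ * (b - a * σ ^ 2) = c ^ 2 * σ := fun {σ} hσ e => by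
    refine mul_left_cancel₀ hσ ?_
    linear_combination (b - a * σ ^ 2) * y2 hσ + e
  -- The coefficient of `φ(0)`. Since `Y⁽¹⁾/σ = a - b/σ²` and `s t = 1`, the difference is `b(s² -
  -- t²)`; this is what fixes the normalization by `R`.
  have flux1 : a * (Y1 lam mu mus s / s - Y1 lam mu mus t / t) = -R := by
    have : a * (Y1 lam mu mus s / s - Y1 lam mu mus t / t) =
        a * (b * (s ^ 2 - t ^ 2)) * (s * t)⁻¹ ^ 2 := by
      field_simp
      linear_combination a * t ^ 2 * y1 hs0 - a * s ^ 2 * y1 ht0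
    rw [this, hst]
    linear_combination -hd
  have flux2 : b * (Y2 lam mu mus s / s - Y2 lam mu mus t / t) = -R := by
    have : b * (Y2 lam mu mus s / s - Y2 lam mu mus t / t) =
        b * (a * (s ^ 2 - t ^ 2)) * (s * t)⁻¹ ^ 2 := by
      field_simp
      linear_combination b * t ^ 2 * y2 hs0 - b * s ^ 2 * y2 ht0
    rw [this, hst]
    linear_combination -hd
  obtain ⟨κ, hκ⟩ : ∃ κ : ℂ, κ = 1 / (4 * Real.pi * R) := ⟨_, rfl⟩
  have hκ1 : 4 * Real.pi * κ * R = 1 := by rw [hκ]; field_simp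
  have hκ2 : ∀ X : ℂ, X / (4 * Real.pi * R) = X * κ := fun X => by rw [hκ]; ring
  have hκ3 : ∀ X : ℂ, X / (2 * Real.pi * R) = 2 * X * κ := fun X => by rw [hκ]; ring
  simp only [hκ2, hκ3]
  constructor
  · linear_combination 4 * Real.pi * κ * P.1 * F * flux1 - P.1 * F * hκ1 +
      2 * κ * P.1 * βs * k1 hs0 es - 2 * κ * P.1 * βt * k1 ht0 et -
      2 * κ * c * P.2 * s * γs * y2 hs0 + 2 * κ * c * P.2 * t * γt * y2 ht0
  · linear_combination 4 * Real.pi * κ * P.2 * F * flux2 - P.2 * F * hκ1 +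
      2 * κ * P.2 * βs * k2 hs0 es - 2 * κ * P.2 * βt * k2 ht0 et -
      2 * κ * c * P.1 * s * γs * y1 hs0 + 2 * κ * c * P.1 * t * γt * y1 ht0

theorem isEquilibrium_pointForce
    (h : IsCharPair (lam + 2 * mu) mus (lam + mus) (sqrtQ lam mu mus) (s₁ lam mu mus)
      (s₂ lam mu mus)) (P : ℝ × ℝ) :
    IsEquilibrium lam mu mus (pointForce lam mu mus P) (fun φ => P.1 * φ (0, 0))
      (fun φ => P.2 * φ (0, 0)) := by
  rw [pointForce_eq h]
  have l1 := h.locallyIntegrable_potential (P.1 / (4 * Real.pi * sqrtQ lam mu mus) *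
    Y1 lam mu mus (s₁ lam mu mus)) (-(P.1 / (4 * Real.pi * sqrtQ lam mu mus) *
    Y1 lam mu mus (s₂ lam mu mus))) (P.2 * (lam + mus) / (2 * Real.pi * sqrtQ lam mu mus))
  have l2 := h.locallyIntegrable_potential (P.2 / (4 * Real.pi * sqrtQ lam mu mus) *
    Y2 lam mu mus (s₁ lam mu mus)) (-(P.2 / (4 * Real.pi * sqrtQ lam mu mus) *
    Y2 lam mu mus (s₂ lam mu mus))) (P.1 * (lam + mus) / (2 * Real.pi * sqrtQ lam mu mus))
  refine ⟨locallyIntegrable_prodMk l1 l2, fun φ hφ hc => ?_⟩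
  have c11 := (contDiff_pd₁ (contDiff_pd₁ hφ)).continuous
  have c22 := (contDiff_pd₂ (contDiff_pd₂ hφ)).continuous
  have c12 := (contDiff_pd₁ (contDiff_pd₂ hφ)).continuous
  have s11 := hasCompactSupport_pd₁ (hasCompactSupport_pd₁ hc)
  have s22 := hasCompactSupport_pd₂ (hasCompactSupport_pd₂ hc)
  have s12 := hasCompactSupport_pd₁ (hasCompactSupport_pd₂ hc)
  obtain ⟨w1, w2⟩ := h.weak_force P hφ hc
  refine ⟨?_, ?_⟩
  · refine (congrArg (· + _) ((integral_test_combination l1 l2 c11 c22 c12 s11 s22 s12 _ _ _).trans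
      w1)).trans ?_
    push_cast
    ring
  · refine (congrArg (· + _) ((integral_test_combination l2 l1 c22 c11 c12 s22 s11 s12 _ _ _).trans
      w2)).trans ?_
    push_cast
    ring

/-! ### The center of dilatation -/

/-- Makes the second component antisymmetric in the roots up to the factor `1/R`. The term with `x₁²
x₂` is split by `t² r_s² - s² r_t² = (t² - s²) x₁²` and `R = a b (t² - s²)`. -/
theorem dilatationField_eq
    (h : IsCharPair (lam + 2 * mu) mus (lam + mus) (sqrtQ lam mu mus) (s₁ lam mu mus)
      (s₂ lam mu mus)) {s t R : ℂ} (hs : s = s₁ lam mu mus) (ht : t = s₂ lam mu mus)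
      (hR : R = sqrtQ lam mu mus) (x : ℝ × ℝ) :
    dilatationField lam mu mus x =
      ((x.1 : ℂ) / (4 * Real.pi * R) *
        (((lam + mus) * s - Y1 lam mu mus s) / quadForm 1 0 (s ^ 2) x -
          ((lam + mus) * t - Y1 lam mu mus t) / quadForm 1 0 (t ^ 2) x),
      (x.2 : ℂ) / (4 * Real.pi * R) *
        (((lam + mus) * t + Y2 lam mu mus t * t ^ 2) / quadForm 1 0 (t ^ 2) x -
          ((lam + mus) * s + Y2 lam mu mus s * s ^ 2) / quadForm 1 0 (s ^ 2) x)) := by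
  simp only [dilatationField, rad_sq]
  rw [← hs, ← ht, ← hR] at h ⊢
  rcases eq_or_ne x 0 with rfl | hx
  · simp
  refine Prod.ext rfl ?_
  have n1 := Complex.slitPlane_ne_zero (quadForm_sq_mem_slitPlane h.s_re x hx)
  have n2 := Complex.slitPlane_ne_zero (quadForm_sq_mem_slitPlane h.t_re x hx)
  have hpi : (Real.pi : ℂ) ≠ 0 := by exact_mod_cast Real.pi_ne_zero
  have hR := h.R_ne
  have hb : (mus : ℂ) ≠ 0 := by exact_mod_cast h.b_pos.ne'
  have ha : (lam : ℂ) + 2 * mu ≠ 0 := by exact_mod_cast h.a_pos.ne'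
  have hd := h.diff
  push_cast at hd
  have key : Y2 lam mu mus t / (4 * Real.pi * mus * (lam + 2 * mu)) *
      ((x.1 : ℂ) ^ 2 * x.2 / (quadForm 1 0 (s ^ 2) x * quadForm 1 0 (t ^ 2) x)) =
      x.2 / (4 * Real.pi * R) * (Y2 lam mu mus t * t ^ 2 / quadForm 1 0 (t ^ 2) x -
        Y2 lam mu mus t * s ^ 2 / quadForm 1 0 (s ^ 2) x) := by
    have e : t ^ 2 * quadForm 1 0 (s ^ 2) x - s ^ 2 * quadForm 1 0 (t ^ 2) x =
        (t ^ 2 - s ^ 2) * (x.1 : ℂ) ^ 2 := by simp only [quadForm]; ring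
    rw [← hd] at hR ⊢
    have hts : t ^ 2 - s ^ 2 ≠ 0 := (mul_ne_zero_iff.1 hR).2
    generalize quadForm 1 0 (s ^ 2) x = p at *
    generalize quadForm 1 0 (t ^ 2) x = q at *
    generalize Y2 lam mu mus t = y at *
    field_simp
    linear_combination (-(x.2 : ℂ) * y) * e
  simp only
  rw [key]
  ring

/-- The three relations say that `e ⊗ e + f ⊗ f` is the identity. The derivative along `v` of the
field of the force `v` is quadratic in `v`, so the sum over the frame depends on this tensor only;
hence the invariance under rotations. -/
theorem dilatationField_eq_grad
    (h : IsCharPair (lam + 2 * mu) mus (lam + mus) (sqrtQ lam mu mus) (s₁ lam mu mus)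
      (s₂ lam mu mus)) {s t R : ℂ} (hs : s = s₁ lam mu mus) (ht : t = s₂ lam mu mus)
      (hR : R = sqrtQ lam mu mus) {e f : ℝ × ℝ} (h1 : e.1 ^ 2 + f.1 ^ 2 = 1)
      (h2 : e.2 ^ 2 + f.2 ^ 2 = 1) (h3 : e.1 * e.2 + f.1 * f.2 = 0) (x : ℝ × ℝ) :
    dilatationField lam mu mus x =
      (-(1 / 2) * (gradForce₁ lam mu mus R s t e e x + gradForce₁ lam mu mus R s t f f x),
        -(1 / 2) * (gradForce₂ lam mu mus R s t e e x + gradForce₂ lam mu mus R s t f f x)) := by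
  rw [dilatationField_eq h hs ht hR]
  have h1' : (e.1 : ℂ) ^ 2 + (f.1 : ℂ) ^ 2 = 1 := by exact_mod_cast h1
  have h2' : (e.2 : ℂ) ^ 2 + (f.2 : ℂ) ^ 2 = 1 := by exact_mod_cast h2
  have h3' : (e.1 : ℂ) * e.2 + (f.1 : ℂ) * f.2 = 0 := by exact_mod_cast h3
  simp only [gradForce₁, gradForce₂, gradPotential]
  generalize quadForm 1 0 (s ^ 2) x = p
  generalize quadForm 1 0 (t ^ 2) x = q
  generalize Y1 lam mu mus s = y1s
  generalize Y1 lam mu mus t = y1t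
  generalize Y2 lam mu mus s = y2s
  generalize Y2 lam mu mus t = y2t
  obtain ⟨κ, hκ⟩ : ∃ κ : ℂ, κ = 1 / (4 * Real.pi * R) := ⟨_, rfl⟩
  have hκ2 : ∀ X : ℂ, X / (4 * Real.pi * R) = X * κ := fun X => by rw [hκ]; ring
  have hκ3 : ∀ X : ℂ, X / (2 * Real.pi * R) = 2 * X * κ := fun X => by rw [hκ]; ring
  simp only [hκ2, hκ3]
  refine Prod.ext ?_ ?_
  · linear_combination (κ * x.1 / p * y1s - κ * x.1 / q * y1t) * h1' -
      (κ * x.1 / p * (lam + mus) * s - κ * x.1 / q * (lam + mus) * t) * h2' +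
      (κ * x.2 / p * (y1s * s ^ 2 + (lam + mus) * s) -
        κ * x.2 / q * (y1t * t ^ 2 + (lam + mus) * t)) * h3'
  · linear_combination (κ * x.2 / p * (lam + mus) * s - κ * x.2 / q * (lam + mus) * t) * h1' +
      (κ * x.2 / p * y2s * s ^ 2 - κ * x.2 / q * y2t * t ^ 2) * h2' +
      (κ * x.1 / p * (y2s - (lam + mus) * s) - κ * x.1 / q * (y2t - (lam + mus) * t)) * h3'

/-- By `dilatationField_eq_grad` with the standard frame, pairing the field with `ψ` is half the sum
of the pairings of the unit-force fields with `∂₁ψ` and `∂₂ψ`. The equations are therefore half the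
sum of those for the force `e₁` tested on `∂₁φ` and for the force `e₂` tested on `∂₂φ`. -/
theorem isEquilibrium_dilatationField
    (h : IsCharPair (lam + 2 * mu) mus (lam + mus) (sqrtQ lam mu mus) (s₁ lam mu mus)
      (s₂ lam mu mus)) :
    IsEquilibrium lam mu mus (dilatationField lam mu mus)
      (fun φ => 1 / 2 * pd₁ φ (0, 0)) (fun φ => 1 / 2 * pd₂ φ (0, 0)) := by
  obtain ⟨R, hR⟩ : ∃ R, R = sqrtQ lam mu mus := ⟨_, rfl⟩
  obtain ⟨s, hs⟩ : ∃ s, s = s₁ lam mu mus := ⟨_, rfl⟩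
  obtain ⟨t, ht⟩ : ∃ t, t = s₂ lam mu mus := ⟨_, rfl⟩
  rw [funext (dilatationField_eq_grad h hs ht hR (e := (1, 0)) (f := (0, 1)) (by simp) (by simp)
    (by simp))]
  rw [← hs, ← ht, ← hR] at h
  have l : ∀ P v, LocallyIntegrable (gradForce₁ lam mu mus R s t P v) volume ∧
      LocallyIntegrable (gradForce₂ lam mu mus R s t P v) volume := fun P v =>
    ⟨h.locallyIntegrable_gradPotential _ _ _ _, h.locallyIntegrable_gradPotential _ _ _ _⟩
  have l1 : LocallyIntegrable (fun x => -(1 / 2 : ℂ) * (gradForce₁ lam mu mus R s t (1, 0) (1, 0) x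
      + gradForce₁ lam mu mus R s t (0, 1) (0, 1) x)) volume :=
    ((l _ _).1.add (l _ _).1).smul (-(1 / 2 : ℂ))
  have l2 : LocallyIntegrable (fun x => -(1 / 2 : ℂ) * (gradForce₂ lam mu mus R s t (1, 0) (1, 0) x
      + gradForce₂ lam mu mus R s t (0, 1) (0, 1) x)) volume :=
    ((l _ _).2.add (l _ _).2).smul (-(1 / 2 : ℂ))
  refine ⟨locallyIntegrable_prodMk l1 l2, fun φ hφ hc => ?_⟩
  have d1 := contDiff_pd₁ hφ
  have d2 := contDiff_pd₂ hφ
  have k1 := hasCompactSupport_pd₁ hc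
  have k2 := hasCompactSupport_pd₂ hc
  -- each pairing moves one derivative back to the test function
  have pair : ∀ {g₁ g₂ : ℝ × ℝ → ℂ} {A B C A' B' C' : ℂ} {ψ : ℝ × ℝ → ℝ},
      g₁ = gradPotential s t A B C (1, 0) → g₂ = gradPotential s t A' B' C' (0, 1) →
      ContDiff ℝ ∞ ψ → HasCompactSupport ψ →
      ∫ x, (ψ x : ℂ) * (-(1 / 2 : ℂ) * (g₁ x + g₂ x)) =
        1 / 2 * (∫ x, (pd₁ ψ x : ℂ) * potential s t A B C x) +
        1 / 2 * ∫ x, (pd₂ ψ x : ℂ) * potential s t A' B' C' x := by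
    rintro _ _ A B C A' B' C' ψ rfl rfl hψ hψc
    rw [h.integral_pd₁_potential _ _ _ hψ hψc, h.integral_pd₂_potential _ _ _ hψ hψc]
    have := integral_linear
      (integrable_test_mul (h.locallyIntegrable_gradPotential A B C (1, 0)) hψ.continuous hψc)
      (integrable_test_mul (h.locallyIntegrable_gradPotential A' B' C' (0, 1)) hψ.continuous hψc)
      (-(1 / 2)) (-(1 / 2))
    rw [mul_neg, mul_neg, ← neg_mul, ← neg_mul, ← this]
    congr 1
    funext x
    ring
  have pair₁ : ∀ {ψ : ℝ × ℝ → ℝ}, ContDiff ℝ ∞ ψ → HasCompactSupport ψ →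
      ∫ x, (ψ x : ℂ) * (-(1 / 2 : ℂ) * (gradForce₁ lam mu mus R s t (1, 0) (1, 0) x +
          gradForce₁ lam mu mus R s t (0, 1) (0, 1) x)) =
        1 / 2 * (∫ x, (pd₁ ψ x : ℂ) * forcePotential₁ lam mu mus R s t (1, 0) x) +
        1 / 2 * ∫ x, (pd₂ ψ x : ℂ) * forcePotential₁ lam mu mus R s t (0, 1) x :=
    fun hψ hψc => pair rfl rfl hψ hψc
  have pair₂ : ∀ {ψ : ℝ × ℝ → ℝ}, ContDiff ℝ ∞ ψ → HasCompactSupport ψ →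
      ∫ x, (ψ x : ℂ) * (-(1 / 2 : ℂ) * (gradForce₂ lam mu mus R s t (1, 0) (1, 0) x +
          gradForce₂ lam mu mus R s t (0, 1) (0, 1) x)) =
        1 / 2 * (∫ x, (pd₁ ψ x : ℂ) * forcePotential₂ lam mu mus R s t (1, 0) x) +
        1 / 2 * ∫ x, (pd₂ ψ x : ℂ) * forcePotential₂ lam mu mus R s t (0, 1) x :=
    fun hψ hψc => pair rfl rfl hψ hψc
  have p111 : pd₁ (pd₂ (pd₁ φ)) = pd₁ (pd₁ (pd₂ φ)) := by rw [pd₁_pd₂_comm hφ]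
  have p211 : pd₂ (pd₁ (pd₁ φ)) = pd₁ (pd₁ (pd₂ φ)) := by
    rw [← pd₁_pd₂_comm d1, p111]
  have p122 : pd₁ (pd₂ (pd₂ φ)) = pd₂ (pd₂ (pd₁ φ)) := by
    rw [pd₁_pd₂_comm d2, pd₁_pd₂_comm hφ]
  have p212 : pd₂ (pd₁ (pd₂ φ)) = pd₁ (pd₂ (pd₂ φ)) := (pd₁_pd₂_comm d2).symm
  have c11 := contDiff_pd₁ d1
  have c22 := contDiff_pd₂ d2
  have c12 := contDiff_pd₁ d2
  have s11 := hasCompactSupport_pd₁ k1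
  have s22 := hasCompactSupport_pd₂ k2
  have s12 := hasCompactSupport_pd₁ k2
  obtain ⟨u1, u2⟩ := h.weak_force (1, 0) d1 k1
  obtain ⟨v1, v2⟩ := h.weak_force (0, 1) d2 k2
  push_cast at u1 u2 v1 v2
  refine ⟨?_, ?_⟩
  · have e := integral_test_combination l1 l2 c11.continuous c22.continuous c12.continuous s11 s22
      s12 (lam + 2 * mu) mus (lam + mus)
    rw [pair₁ c11 s11, pair₁ c22 s22, pair₂ c12 s12] at e
    refine (congrArg (· + _) e).trans ?_
    rw [p211, p122, p212]
    rw [p111] at u1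
    push_cast
    linear_combination (1 / 2 : ℂ) * u1 + (1 / 2 : ℂ) * v1
  · have e := integral_test_combination l2 l1 c22.continuous c11.continuous c12.continuous s22 s11
      s12 (lam + 2 * mu) mus (lam + mus)
    rw [pair₂ c22 s22, pair₂ c11 s11, pair₁ c12 s12] at e
    refine (congrArg (· + _) e).trans ?_
    rw [p211, p122, p212]
    rw [p111] at u2
    push_cast
    linear_combination (1 / 2 : ℂ) * u2 + (1 / 2 : ℂ) * v2

/-! ### The dipole limit -/

theorem hasDerivAt_pointForce
    (h : IsCharPair (lam + 2 * mu) mus (lam + mus) (sqrtQ lam mu mus) (s₁ lam mu mus)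
      (s₂ lam mu mus)) (P : ℝ × ℝ) {l : ℝ → ℝ × ℝ} {v : ℝ × ℝ} {τ : ℝ} (hl : HasDerivAt l v τ)
    (hx : l τ ≠ 0) :
    HasDerivAt (fun τ => pointForce lam mu mus P (l τ))
      (gradForce₁ lam mu mus (sqrtQ lam mu mus) (s₁ lam mu mus) (s₂ lam mu mus) P v (l τ),
        gradForce₂ lam mu mus (sqrtQ lam mu mus) (s₁ lam mu mus) (s₂ lam mu mus) P v (l τ)) τ := by
  rw [pointForce_eq h]
  exact (h.hasDerivAt_potential _ _ _ hl hx).prodMk (h.hasDerivAt_potential _ _ _ hl hx)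

theorem contDiffAt_pointForce
    (h : IsCharPair (lam + 2 * mu) mus (lam + mus) (sqrtQ lam mu mus) (s₁ lam mu mus)
      (s₂ lam mu mus)) (P : ℝ × ℝ) {x : ℝ × ℝ} (hx : x ≠ 0) {n : WithTop ℕ∞} :
    ContDiffAt ℝ n (pointForce lam mu mus P) x := by
  rw [pointForce_eq h]
  exact (h.contDiffAt_potential _ _ _ hx).prodMk (h.contDiffAt_potential _ _ _ hx)

theorem gradForce_smul (R s t : ℂ) (P v x : ℝ × ℝ) (r : ℝ) :
    gradForce₁ lam mu mus R s t P (r • v) x = r * gradForce₁ lam mu mus R s t P v x ∧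
      gradForce₂ lam mu mus R s t P (r • v) x = r * gradForce₂ lam mu mus R s t P v x := by
  simp only [gradForce₁, gradForce₂, gradPotential, Prod.smul_fst, Prod.smul_snd, smul_eq_mul]
  push_cast
  constructor <;> ring

/-- The two ends of an arm move with velocities `∓1/4` and carry opposite forces, which gives the
factor `-1/2` of `dilatationField_eq_grad`. -/
theorem hasDerivAt_rotatedDipolePair
    (h : IsCharPair (lam + 2 * mu) mus (lam + mus) (sqrtQ lam mu mus) (s₁ lam mu mus)
      (s₂ lam mu mus)) {x : ℝ × ℝ} (hx : x ≠ 0) (a : ℝ) :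
    HasDerivAt (rotatedDipolePair lam mu mus a x) (dilatationField lam mu mus x) 0 := by
  have hm : ∀ v : ℝ × ℝ, HasDerivAt (fun d : ℝ => x - (d / 4) • v) ((-(1 / 4) : ℝ) • v) 0 := by
    intro v
    simpa using (((hasDerivAt_id (0 : ℝ)).div_const 4).smul_const v).const_sub x
  have hp : ∀ v : ℝ × ℝ, HasDerivAt (fun d : ℝ => x + (d / 4) • v) ((1 / 4 : ℝ) • v) 0 := by
    intro v
    simpa using (((hasDerivAt_id (0 : ℝ)).div_const 4).smul_const v).const_add x
  have hm' := fun v P => hasDerivAt_pointForce h P (hm v) (by simpa using hx)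
  have hp' := fun v P => hasDerivAt_pointForce h P (hp v) (by simpa using hx)
  refine ((((hm' (Real.cos a, Real.sin a) _).sub (hp' (Real.cos a, Real.sin a) _)).add
    (hm' (-Real.sin a, Real.cos a) _)).sub (hp' (-Real.sin a, Real.cos a) _)).congr_deriv ?_
  rw [dilatationField_eq_grad h rfl rfl rfl (e := (Real.cos a, Real.sin a))
    (f := (-Real.sin a, Real.cos a)) (by simp) (by simp) (by simp; ring)]
  simp only [(gradForce_smul _ _ _ _ _ _ _).1, (gradForce_smul _ _ _ _ _ _ _).2, zero_div,
    zero_smul, sub_zero, add_zero]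
  refine Prod.ext ?_ ?_ <;>
  · simp only [Prod.fst_sub, Prod.fst_add, Prod.snd_sub, Prod.snd_add]
    push_cast
    ring

theorem dipolePair_eq (x : ℝ × ℝ) :
    dipolePair lam mu mus x = rotatedDipolePair lam mu mus 0 x := by
  funext d
  have e1 : x - (d / 4) • ((1, 0) : ℝ × ℝ) = (x.1 - d / 4, x.2) := by ext <;> simp
  have e2 : x + (d / 4) • ((1, 0) : ℝ × ℝ) = (x.1 + d / 4, x.2) := by ext <;> simp
  have e3 : x - (d / 4) • ((0, 1) : ℝ × ℝ) = (x.1, x.2 - d / 4) := by ext <;> simp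
  have e4 : x + (d / 4) • ((0, 1) : ℝ × ℝ) = (x.1, x.2 + d / 4) := by ext <;> simp
  simp only [dipolePair, rotatedDipolePair, Real.cos_zero, Real.sin_zero, neg_zero, e1, e2, e3, e4]

theorem contDiffAt_dipolePair
    (h : IsCharPair (lam + 2 * mu) mus (lam + mus) (sqrtQ lam mu mus) (s₁ lam mu mus)
      (s₂ lam mu mus)) {x : ℝ × ℝ} (hx : x ≠ 0) {n : WithTop ℕ∞} :
    ContDiffAt ℝ n (dipolePair lam mu mus x) 0 := by
  have key : ∀ (P : ℝ × ℝ) {l : ℝ → ℝ × ℝ}, ContDiffAt ℝ n l 0 → l 0 = x →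
      ContDiffAt ℝ n (fun d => pointForce lam mu mus P (l d)) 0 := fun P l hl h0 =>
    (contDiffAt_pointForce h P (by rwa [h0])).comp 0 hl
  unfold dipolePair
  refine (((key _ ?_ ?_).sub (key _ ?_ ?_)).add (key _ ?_ ?_)).sub (key _ ?_ ?_) <;>
  first
    | fun_prop
    | simp

theorem dipolePair_limit
    (h : IsCharPair (lam + 2 * mu) mus (lam + mus) (sqrtQ lam mu mus) (s₁ lam mu mus)
      (s₂ lam mu mus)) {x : ℝ × ℝ} (hx : x ≠ 0) :
    HasDerivAt (dipolePair lam mu mus x) (dilatationField lam mu mus x) 0 ∧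
      (∀ᶠ d in 𝓝 (0 : ℝ), DifferentiableAt ℝ (dipolePair lam mu mus x) d) ∧
      Tendsto (deriv (dipolePair lam mu mus x)) (𝓝[≠] 0) (𝓝 (dilatationField lam mu mus x)) := by
  have hd : HasDerivAt (dipolePair lam mu mus x) (dilatationField lam mu mus x) 0 := by
    rw [dipolePair_eq]
    exact hasDerivAt_rotatedDipolePair h hx 0
  have hc : ContDiffAt ℝ 1 (dipolePair lam mu mus x) 0 := contDiffAt_dipolePair h hx
  refine ⟨hd, ?_, ?_⟩
  · filter_upwards [hc.eventually (by simp)] with d hd using hd.differentiableAt one_ne_zero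
  · have hcont : ContinuousAt (deriv (dipolePair lam mu mus x)) 0 :=
      (hc.continuousAt_fderiv one_ne_zero).clm_apply continuousAt_const
    have := hcont.tendsto.mono_left (nhdsWithin_le_nhds (s := {0}ᶜ))
    rwa [hd.deriv] at this

/-! ### Reality -/

theorem conj_logSq {s : ℂ} (hs : 0 < s.re) (x : ℝ × ℝ) :
    conj (logSq s x) = logSq (conj s) x := by
  rcases eq_or_ne x 0 with rfl | hx
  · simp [logSq, quadForm]
  · rw [logSq, logSq,
      ← Complex.log_conj _ (Complex.slitPlane_arg_ne_pi (quadForm_sq_mem_slitPlane hs x hx))]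
    simp [quadForm]

theorem IsCharPair.conj_angDiff {a b c : ℝ} (h : IsCharPair a b c R s t) (x : ℝ × ℝ) :
    conj (angDiff s t x) = angDiff (conj s) (conj t) x := by
  rcases eq_or_ne x 0 with rfl | hx
  · simp [angDiff, quadForm]
  · rw [angDiff, angDiff, map_mul, map_sub,
      ← Complex.log_conj _ (Complex.slitPlane_arg_ne_pi (h.slit_pos x hx)),
      ← Complex.log_conj _ (Complex.slitPlane_arg_ne_pi (h.slit_neg x hx))]
    simp [quadForm, Complex.conj_ofNat]
    ring

theorem angDiff_swap (s t : ℂ) (x : ℝ × ℝ) : angDiff t s x = -angDiff s t x := by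
  rw [angDiff, angDiff, show I * (s - t) = -(I * (t - s)) by ring, neg_neg]
  ring

theorem conj_Y1 (z : ℂ) : conj (Y1 lam mu mus z) = Y1 lam mu mus (conj z) := by simp [Y1, Complex.conj_ofNat]

theorem conj_Y2 (z : ℂ) : conj (Y2 lam mu mus z) = Y2 lam mu mus (conj z) := by simp [Y2, Complex.conj_ofNat]

/-- When the roots are conjugate, conjugation exchanges them and negates `R`; the numerators are
antisymmetric in the roots, so the quotients are unchanged. -/
theorem im_pointForce
    (h : IsCharPair (lam + 2 * mu) mus (lam + mus) (sqrtQ lam mu mus) (s₁ lam mu mus)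
      (s₂ lam mu mus)) (P x : ℝ × ℝ) :
    (pointForce lam mu mus P x).1.im = 0 ∧ (pointForce lam mu mus P x).2.im = 0 := by
  rw [pointForce_eq h, ← Complex.conj_eq_iff_im, ← Complex.conj_eq_iff_im]
  simp only [forcePotential₁, forcePotential₂, potential, map_add, map_mul, map_div₀, map_neg,
    Complex.conj_ofReal, Complex.conj_ofNat, conj_logSq h.s_re, conj_logSq h.t_re, h.conj_angDiff,
    conj_Y1, conj_Y2]
  rcases h.conj_cases with ⟨e1, e2, e3⟩ | ⟨e1, e2, e3⟩
  · simp only [e1, e2, e3, and_self]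
  · simp only [e1, e2, e3, angDiff_swap (s₁ lam mu mus), mul_neg, div_neg]
    constructor <;> ring

theorem im_dilatationField
    (h : IsCharPair (lam + 2 * mu) mus (lam + mus) (sqrtQ lam mu mus) (s₁ lam mu mus)
      (s₂ lam mu mus)) (x : ℝ × ℝ) :
    (dilatationField lam mu mus x).1.im = 0 ∧ (dilatationField lam mu mus x).2.im = 0 := by
  rw [dilatationField_eq h rfl rfl rfl, ← Complex.conj_eq_iff_im, ← Complex.conj_eq_iff_im]
  simp only [quadForm_sq, map_add, map_sub, map_mul, map_div₀, map_pow, Complex.conj_ofReal,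
    Complex.conj_ofNat, conj_Y1, conj_Y2]
  rcases h.conj_cases with ⟨e1, e2, e3⟩ | ⟨e1, e2, e3⟩
  · simp only [e1, e2, e3, and_self]
  · simp only [e1, e2, e3, mul_neg, div_neg]
    constructor <;> ring

end

/-! ### The isotropic limit -/

section
variable {lam mu mus : ℝ}

/-- The field of the center of dilatation with the factor `s₂ - s₁` cancelled. -/
theorem dilatationField_eq_regular
    (h : IsCharPair (lam + 2 * mu) mus (lam + mus) (sqrtQ lam mu mus) (s₁ lam mu mus)
      (s₂ lam mu mus)) {s t : ℂ} (hs : s = s₁ lam mu mus) (ht : t = s₂ lam mu mus)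
    {x : ℝ × ℝ} (hx : x ≠ 0) :
    dilatationField lam mu mus x =
      ((x.1 : ℂ) * (2 * mu * (x.1 : ℂ) ^ 2 +
          (mus * (s ^ 2 + t ^ 2 + 1) - (2 * mu - mus)) * (x.2 : ℂ) ^ 2) /
        (4 * Real.pi * (mus * (lam + 2 * mu)) * (s + t) *
          (quadForm 1 0 (s ^ 2) x * quadForm 1 0 (t ^ 2) x)),
      (x.2 : ℂ) * ((mus * (s ^ 2 + t ^ 2 + 1) - (2 * mu - mus)) * (x.1 : ℂ) ^ 2 +
          2 * mu * (x.2 : ℂ) ^ 2) /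
        (4 * Real.pi * (mus * (lam + 2 * mu)) * (s + t) *
          (quadForm 1 0 (s ^ 2) x * quadForm 1 0 (t ^ 2) x))) := by
  rw [dilatationField_eq h hs ht rfl]
  rw [← hs, ← ht] at h
  have n1 := Complex.slitPlane_ne_zero (quadForm_sq_mem_slitPlane h.s_re x hx)
  have n2 := Complex.slitPlane_ne_zero (quadForm_sq_mem_slitPlane h.t_re x hx)
  have hpi : (Real.pi : ℂ) ≠ 0 := by exact_mod_cast Real.pi_ne_zero
  have hb : (mus : ℂ) ≠ 0 := by exact_mod_cast h.b_pos.ne'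
  have ha : (lam : ℂ) + 2 * mu ≠ 0 := by exact_mod_cast h.a_pos.ne'
  have hst := h.mul_eq
  have hs0 : s ≠ 0 := left_ne_zero_of_mul_eq_one hst
  have ht0 : t ≠ 0 := right_ne_zero_of_mul_eq_one hst
  have hR := h.R_ne
  rw [← h.diff] at hR ⊢
  have hts := (mul_ne_zero_iff.1 hR).2
  rw [sq_sub_sq] at hts ⊢
  have hplus : s + t ≠ 0 := by rw [add_comm]; exact (mul_ne_zero_iff.1 hts).1
  have hplus' : t + s ≠ 0 := (mul_ne_zero_iff.1 hts).1
  have hminus : t - s ≠ 0 := (mul_ne_zero_iff.1 hts).2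
  have y1s : Y1 lam mu mus s = (lam + 2 * mu) * s - mus * t := by
    rw [Y1]; field_simp; linear_combination mus * hst
  have y1t : Y1 lam mu mus t = (lam + 2 * mu) * t - mus * s := by
    rw [Y1]; field_simp; linear_combination mus * hst
  have y2s : Y2 lam mu mus s * s ^ 2 = (mus * s ^ 2 - (lam + 2 * mu)) * s := by
    rw [Y2]; field_simp
  have y2t : Y2 lam mu mus t * t ^ 2 = (mus * t ^ 2 - (lam + 2 * mu)) * t := by
    rw [Y2]; field_simp
  rw [y1s, y1t, y2s, y2t]
  have hp := quadForm_sq s x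
  have hq := quadForm_sq t x
  generalize quadForm 1 0 (s ^ 2) x = p at *
  generalize quadForm 1 0 (t ^ 2) x = q at *
  push_cast
  -- Antisymmetry in the roots makes both numerators divisible by `t - s`, the factor of `R = a b (t
  -- + s)(t - s)` that vanishes in the isotropic limit.
  have e1 : ((lam + mus) * s - ((lam + 2 * mu) * s - mus * t)) * q -
      ((lam + mus) * t - ((lam + 2 * mu) * t - mus * s)) * p = (t - s) *
      (2 * mu * (x.1 : ℂ) ^ 2 +
        (mus * (s ^ 2 + t ^ 2 + 1) - (2 * mu - mus)) * (x.2 : ℂ) ^ 2) := by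
    rw [hp, hq]
    linear_combination ((t - s) * (mus - (2 * mu - mus)) * (x.2 : ℂ) ^ 2) * hst
  have e2 : ((lam + mus) * t + (mus * t ^ 2 - (lam + 2 * mu)) * t) * p -
      ((lam + mus) * s + (mus * s ^ 2 - (lam + 2 * mu)) * s) * q = (t - s) *
      ((mus * (s ^ 2 + t ^ 2 + 1) - (2 * mu - mus)) * (x.1 : ℂ) ^ 2 +
        2 * mu * (x.2 : ℂ) ^ 2) := by
    rw [hp, hq]
    linear_combination ((t - s) * mus * (x.1 : ℂ) ^ 2 +
      (t - s) * (mus * (s * t + 1) + (2 * mu - mus)) * (x.2 : ℂ) ^ 2) * hst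
  have cancel : ∀ A B X y : ℂ, A * q - B * p = (t - s) * X →
      y / (4 * Real.pi * ((lam + 2 * mu) * mus * ((t + s) * (t - s)))) * (A / p - B / q) =
        y * X / (4 * Real.pi * (mus * (lam + 2 * mu)) * (s + t) * (p * q)) := by
    intro A B X y hX
    rw [div_sub_div _ _ n1 n2, show A * q - p * B = A * q - B * p by ring, hX]
    field_simp
    ring
  refine Prod.ext (cancel _ _ _ _ e1) ?_
  have := cancel _ _ _ (x.2 : ℂ) (show (-((lam + mus) * s + (mus * s ^ 2 - (lam + 2 * mu)) * s)) * q
    - (-((lam + mus) * t + (mus * t ^ 2 - (lam + 2 * mu)) * t)) * p = _ by rw [← e2]; ring)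
  rw [← this]
  ring

/-- The origin is included because `q` tends to 0, through negative values when `μ* > μ`; there
`‖√w‖ = √‖w‖` suffices although the branch cut ends at 0. -/
theorem continuousAt_sqrt {z : ℂ} (hz : z ∈ Complex.slitPlane ∨ z = 0) :
    ContinuousAt Complex.sqrt z := by
  rcases hz with hz | rfl
  · exact continuousAt_cpow_const hz
  · have hn : ∀ w : ℂ, ‖Complex.sqrt w‖ = √‖w‖ := fun w => by
      rw [← Real.sqrt_sq (norm_nonneg _), ← norm_pow, sqrt_sq]
    have h : Tendsto (fun w : ℂ => √‖w‖) (𝓝 0) (𝓝 (√‖(0 : ℂ)‖)) :=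
      (Real.continuous_sqrt.comp continuous_norm).tendsto 0
    rw [ContinuousAt, Complex.sqrt_zero, tendsto_zero_iff_norm_tendsto_zero]
    simpa [hn] using h

theorem tendsto_sqrtQ (lam mu : ℝ) : Tendsto (fun mus => sqrtQ lam mu mus) (𝓝 mu) (𝓝 0) := by
  have h1 : Tendsto (fun mus : ℝ => ((qCoef lam mu mus : ℝ) : ℂ)) (𝓝 mu) (𝓝 0) := by
    have hc : Continuous fun mus : ℝ => ((qCoef lam mu mus : ℝ) : ℂ) := by
      unfold qCoef; fun_prop
    simpa [qCoef] using hc.tendsto mu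
  have h2 := (continuousAt_sqrt (z := 0) (.inr rfl)).tendsto.comp h1
  simpa [Function.comp_def, sqrtQ] using h2

theorem tendsto_s₁_s₂ (hmu : 0 < mu) (hlam : 0 < lam + mu) :
    Tendsto (fun mus => s₁ lam mu mus) (𝓝 mu) (𝓝 1) ∧
      Tendsto (fun mus => s₂ lam mu mus) (𝓝 mu) (𝓝 1) := by
  have hD : 0 < 2 * mu * (lam + 2 * mu) := by
    have : 0 < lam + 2 * mu := by linarith
    positivity
  have hslit : ((2 * mu * (lam + 2 * mu) : ℝ) : ℂ) ∈ Complex.slitPlane :=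
    Complex.ofReal_mem_slitPlane.2 hD
  have hp : Tendsto (fun mus : ℝ => -((pCoef lam mu mus : ℝ) : ℂ)) (𝓝 mu)
      (𝓝 ((2 * mu * (lam + 2 * mu) : ℝ) : ℂ)) := by
    have hc : Continuous fun mus : ℝ => -((pCoef lam mu mus : ℝ) : ℂ) := by
      unfold pCoef; fun_prop
    convert hc.tendsto mu using 2
    rw [pCoef]; push_cast; ring
  have hd : Tendsto (fun mus : ℝ => ((2 * mus * (lam + 2 * mu) : ℝ) : ℂ)) (𝓝 mu)
      (𝓝 ((2 * mu * (lam + 2 * mu) : ℝ) : ℂ)) := by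
    have hc : Continuous fun mus : ℝ => ((2 * mus * (lam + 2 * mu) : ℝ) : ℂ) := by fun_prop
    exact hc.tendsto mu
  have hsq := (continuousAt_sqrt (.inl hslit)).tendsto
  have hne : Complex.sqrt ((2 * mu * (lam + 2 * mu) : ℝ) : ℂ) ≠ 0 := fun h0 => by
    have := sqrt_re_pos hslit
    rw [h0] at this
    simp at this
  have hone : 1 / Complex.sqrt ((2 * mu * (lam + 2 * mu) : ℝ) : ℂ) *
      Complex.sqrt ((2 * mu * (lam + 2 * mu) : ℝ) : ℂ) = 1 := by field_simp
  have h1 := (tendsto_const_nhds (x := (1 : ℂ))).div (hsq.comp hd) hne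
  have h2 := hsq.comp (by simpa using hp.sub (tendsto_sqrtQ lam mu))
  have h3 := hsq.comp (by simpa using hp.add (tendsto_sqrtQ lam mu))
  have r1 := h1.mul h2
  have r2 := h1.mul h3
  rw [hone] at r1 r2
  exact ⟨r1, r2⟩

theorem tendsto_Y1 (lam mu : ℝ) {s : ℝ → ℂ} (hs : Tendsto s (𝓝 mu) (𝓝 1)) :
    Tendsto (fun mus => Y1 lam mu mus (s mus)) (𝓝 mu) (𝓝 ((lam : ℂ) + mu)) := by
  have hm : Tendsto (fun mus : ℝ => (mus : ℂ)) (𝓝 mu) (𝓝 (mu : ℂ)) :=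
    Complex.continuous_ofReal.tendsto mu
  have := (((hs.pow 2).const_mul ((lam : ℂ) + 2 * mu)).sub hm).div hs one_ne_zero
  rwa [show (lam : ℂ) + mu = ((lam + 2 * mu) * 1 ^ 2 - mu) / 1 by ring]

theorem tendsto_Y2 (lam mu : ℝ) {s : ℝ → ℂ} (hs : Tendsto s (𝓝 mu) (𝓝 1)) :
    Tendsto (fun mus => Y2 lam mu mus (s mus)) (𝓝 mu) (𝓝 (-((lam : ℂ) + mu))) := by
  have hm : Tendsto (fun mus : ℝ => (mus : ℂ)) (𝓝 mu) (𝓝 (mu : ℂ)) :=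
    Complex.continuous_ofReal.tendsto mu
  have := ((hm.mul (hs.pow 2)).sub_const ((lam : ℂ) + 2 * mu)).div hs one_ne_zero
  rwa [show -((lam : ℂ) + mu) = (mu * 1 ^ 2 - (lam + 2 * mu)) / 1 by ring]

theorem tendsto_quadForm {s : ℝ → ℂ} (hs : Tendsto s (𝓝 mu) (𝓝 1)) (x : ℝ × ℝ) :
    Tendsto (fun mus => quadForm 1 0 (s mus ^ 2) x) (𝓝 mu)
      (𝓝 (((x.1 ^ 2 + x.2 ^ 2 : ℝ) : ℂ))) := by
  simp only [quadForm_sq]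
  have := ((hs.pow 2).mul_const ((x.2 : ℂ) ^ 2)).const_add ((x.1 : ℂ) ^ 2)
  convert this using 2
  push_cast
  ring

theorem tendsto_rad {s : ℝ → ℂ} (hs : Tendsto s (𝓝 mu) (𝓝 1)) (x : ℝ × ℝ) :
    Tendsto (fun mus => rad (s mus) x) (𝓝 mu) (𝓝 ((√(x.1 ^ 2 + x.2 ^ 2) : ℝ) : ℂ)) := by
  have h0 : 0 ≤ x.1 ^ 2 + x.2 ^ 2 := by positivity
  rw [← sqrt_ofReal h0]
  have hz : ((x.1 ^ 2 + x.2 ^ 2 : ℝ) : ℂ) ∈ Complex.slitPlane ∨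
      ((x.1 ^ 2 + x.2 ^ 2 : ℝ) : ℂ) = 0 := by
    rcases h0.lt_or_eq with h | h
    · exact .inl (Complex.ofReal_mem_slitPlane.2 h)
    · exact .inr (by rw [← h]; simp)
  refine ((continuousAt_sqrt hz).tendsto.comp (tendsto_quadForm hs x)).congr fun mus => ?_
  simp only [Function.comp_apply, rad, quadForm_sq]

/-- In the regular form the numerators tend to `2μ xᵢ r²` and the denominator to `8π μ(λ + 2μ) r⁴`.
The punctured neighbourhood is needed because that form is derived for `μ* ≠ μ`. -/
theorem tendsto_dilatationField (hmu : 0 < mu) (hlam : 0 < lam + mu) {x : ℝ × ℝ} (hx : x ≠ 0) :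
    Tendsto (fun mus => dilatationField lam mu mus x) (𝓝[≠] mu)
      (𝓝 (isotropicDilatationField lam mu x)) := by
  obtain ⟨hs, ht⟩ := tendsto_s₁_s₂ hmu hlam
  have hm : Tendsto (fun mus : ℝ => (mus : ℂ)) (𝓝 mu) (𝓝 (mu : ℂ)) :=
    Complex.continuous_ofReal.tendsto mu
  have hr : 0 < x.1 ^ 2 + x.2 ^ 2 := by
    by_cases h1 : x.1 = 0
    · have : x.2 ≠ 0 := fun h2 => hx (Prod.ext h1 h2)
      positivity
    · positivity
  have hr' : ((x.1 ^ 2 + x.2 ^ 2 : ℝ) : ℂ) ≠ 0 := by exact_mod_cast hr.ne'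
  have hmu' : (mu : ℂ) ≠ 0 := by exact_mod_cast hmu.ne'
  have ha : (lam : ℂ) + 2 * mu ≠ 0 := by exact_mod_cast (by linarith : 0 < lam + 2 * mu).ne'
  have hpi : (Real.pi : ℂ) ≠ 0 := by exact_mod_cast Real.pi_ne_zero
  have hden := ((((hm.mul_const ((lam : ℂ) + 2 * mu)).const_mul (4 * Real.pi : ℂ)).mul
    (hs.add ht)).mul ((tendsto_quadForm hs x).mul (tendsto_quadForm ht x)))
  have hden0 : 4 * (Real.pi : ℂ) * (mu * (lam + 2 * mu)) * (1 + 1) *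
      (((x.1 ^ 2 + x.2 ^ 2 : ℝ) : ℂ) * ((x.1 ^ 2 + x.2 ^ 2 : ℝ) : ℂ)) ≠ 0 := by
    have : (1 : ℂ) + 1 ≠ 0 := by norm_num
    have h4 : (4 : ℂ) ≠ 0 := by norm_num
    simp only [ne_eq, mul_eq_zero, not_or]
    tauto
  have hk := (hm.mul (((hs.pow 2).add (ht.pow 2)).add_const 1)).sub (hm.const_sub (2 * (mu : ℂ)))
  have l1 := (((hk.mul_const ((x.2 : ℂ) ^ 2)).const_add (2 * mu * (x.1 : ℂ) ^ 2)).const_mul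
    (x.1 : ℂ)).div hden hden0
  have l2 := (((hk.mul_const ((x.1 : ℂ) ^ 2)).add_const (2 * mu * (x.2 : ℂ) ^ 2)).const_mul
    (x.2 : ℂ)).div hden hden0
  have hlim : isotropicDilatationField lam mu x =
      ((x.1 : ℂ) * (2 * mu * (x.1 : ℂ) ^ 2 + (mu * (1 ^ 2 + 1 ^ 2 + 1) - (2 * mu - mu)) *
          (x.2 : ℂ) ^ 2) / (4 * (Real.pi : ℂ) * (mu * (lam + 2 * mu)) * (1 + 1) *
          (((x.1 ^ 2 + x.2 ^ 2 : ℝ) : ℂ) * ((x.1 ^ 2 + x.2 ^ 2 : ℝ) : ℂ))),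
        (x.2 : ℂ) * ((mu * (1 ^ 2 + 1 ^ 2 + 1) - (2 * mu - mu)) * (x.1 : ℂ) ^ 2 +
          2 * mu * (x.2 : ℂ) ^ 2) / (4 * (Real.pi : ℂ) * (mu * (lam + 2 * mu)) * (1 + 1) *
          (((x.1 ^ 2 + x.2 ^ 2 : ℝ) : ℂ) * ((x.1 ^ 2 + x.2 ^ 2 : ℝ) : ℂ)))) := by
    refine Prod.ext ?_ ?_ <;>
    · simp only [isotropicDilatationField]
      push_cast at hr' ⊢
      field_simp
      ring
  rw [hlim]
  refine ((l1.prodMk_nhds l2).mono_left nhdsWithin_le_nhds).congr' ?_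
  filter_upwards [self_mem_nhdsWithin, nhdsWithin_le_nhds (lt_mem_nhds hmu)] with mus hne hpos
  exact (dilatationField_eq_regular (isCharPair hmu hlam hpos hne) rfl rfl hx).symm

end

end CubicDilatation

theorem mainTheorem3 (lam mu : ℝ) (hmu : 0 < mu) (hlam : 0 < lam + mu) :
    -- every positive definite, genuinely cubic material
    (∀ mus : ℝ, 0 < mus → mus ≠ mu →
      -- the field of a concentrated force is real and solves the equations with `f = P δ`
      (∀ P x : ℝ × ℝ, (CubicDilatation.pointForce lam mu mus P x).1.im = 0 ∧
        (CubicDilatation.pointForce lam mu mus P x).2.im = 0) ∧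
      (∀ P : ℝ × ℝ, CubicDilatation.IsEquilibrium lam mu mus
        (CubicDilatation.pointForce lam mu mus P)
        (fun φ => P.1 * φ (0, 0)) (fun φ => P.2 * φ (0, 0))) ∧
      -- the dipole-arm limit is the closed form, also for rotated dipoles
      (∀ x : ℝ × ℝ, x ≠ (0, 0) →
        HasDerivAt (CubicDilatation.dipolePair lam mu mus x)
          (CubicDilatation.dilatationField lam mu mus x) 0 ∧
        (∀ᶠ d in 𝓝 (0 : ℝ), DifferentiableAt ℝ (CubicDilatation.dipolePair lam mu mus x) d) ∧
        Tendsto (deriv (CubicDilatation.dipolePair lam mu mus x)) (𝓝[≠] 0)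
          (𝓝 (CubicDilatation.dilatationField lam mu mus x)) ∧
        (∀ a : ℝ, HasDerivAt (CubicDilatation.rotatedDipolePair lam mu mus a x)
          (CubicDilatation.dilatationField lam mu mus x) 0)) ∧
      -- the closed form is real and solves the equations with `f = -(1/2) ∇δ`
      (∀ x : ℝ × ℝ, (CubicDilatation.dilatationField lam mu mus x).1.im = 0 ∧
        (CubicDilatation.dilatationField lam mu mus x).2.im = 0) ∧
      CubicDilatation.IsEquilibrium lam mu mus (CubicDilatation.dilatationField lam mu mus)
        (fun φ => 1 / 2 * CubicDilatation.pd₁ φ (0, 0))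
        (fun φ => 1 / 2 * CubicDilatation.pd₂ φ (0, 0))) ∧
    -- the isotropic limit
    Tendsto (fun mus : ℝ => CubicDilatation.s₁ lam mu mus) (𝓝[≠] mu) (𝓝 1) ∧
    Tendsto (fun mus : ℝ => CubicDilatation.s₂ lam mu mus) (𝓝[≠] mu) (𝓝 1) ∧
    Tendsto (fun mus : ℝ => CubicDilatation.qCoef lam mu mus) (𝓝[≠] mu) (𝓝 0) ∧
    Tendsto (fun mus : ℝ => CubicDilatation.Y1 lam mu mus (CubicDilatation.s₁ lam mu mus))
      (𝓝[≠] mu) (𝓝 ((lam : ℂ) + mu)) ∧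
    Tendsto (fun mus : ℝ => CubicDilatation.Y1 lam mu mus (CubicDilatation.s₂ lam mu mus))
      (𝓝[≠] mu) (𝓝 ((lam : ℂ) + mu)) ∧
    Tendsto (fun mus : ℝ => CubicDilatation.Y2 lam mu mus (CubicDilatation.s₁ lam mu mus))
      (𝓝[≠] mu) (𝓝 (-((lam : ℂ) + mu))) ∧
    Tendsto (fun mus : ℝ => CubicDilatation.Y2 lam mu mus (CubicDilatation.s₂ lam mu mus))
      (𝓝[≠] mu) (𝓝 (-((lam : ℂ) + mu))) ∧
    (∀ x : ℝ × ℝ,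
      Tendsto (fun mus : ℝ => CubicDilatation.rad (CubicDilatation.s₁ lam mu mus) x) (𝓝[≠] mu)
        (𝓝 ((Real.sqrt (x.1 ^ 2 + x.2 ^ 2) : ℝ) : ℂ)) ∧
      Tendsto (fun mus : ℝ => CubicDilatation.rad (CubicDilatation.s₂ lam mu mus) x) (𝓝[≠] mu)
        (𝓝 ((Real.sqrt (x.1 ^ 2 + x.2 ^ 2) : ℝ) : ℂ))) ∧
    (∀ x : ℝ × ℝ, x ≠ (0, 0) →
      Tendsto (fun mus : ℝ => CubicDilatation.dilatationField lam mu mus x) (𝓝[≠] mu)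
        (𝓝 (CubicDilatation.isotropicDilatationField lam mu x))) := by
  obtain ⟨h1, h2⟩ := CubicDilatation.tendsto_s₁_s₂ hmu hlam
  refine ⟨fun mus hmus hne => ?_, h1.mono_left nhdsWithin_le_nhds, h2.mono_left nhdsWithin_le_nhds,
    ?_, (CubicDilatation.tendsto_Y1 lam mu h1).mono_left nhdsWithin_le_nhds,
    (CubicDilatation.tendsto_Y1 lam mu h2).mono_left nhdsWithin_le_nhds,
    (CubicDilatation.tendsto_Y2 lam mu h1).mono_left nhdsWithin_le_nhds,
    (CubicDilatation.tendsto_Y2 lam mu h2).mono_left nhdsWithin_le_nhds,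
    fun x => ⟨(CubicDilatation.tendsto_rad h1 x).mono_left nhdsWithin_le_nhds,
      (CubicDilatation.tendsto_rad h2 x).mono_left nhdsWithin_le_nhds⟩,
    fun x hx => CubicDilatation.tendsto_dilatationField hmu hlam hx⟩
  · have h := CubicDilatation.isCharPair hmu hlam hmus hne
    refine ⟨CubicDilatation.im_pointForce h, CubicDilatation.isEquilibrium_pointForce h,
      fun x hx => ?_, CubicDilatation.im_dilatationField h,
      CubicDilatation.isEquilibrium_dilatationField h⟩
    obtain ⟨l1, l2, l3⟩ := CubicDilatation.dipolePair_limit h hx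
    exact ⟨l1, l2, l3, CubicDilatation.hasDerivAt_rotatedDipolePair h hx⟩
  · have hc : Continuous fun mus : ℝ => CubicDilatation.qCoef lam mu mus := by
      unfold CubicDilatation.qCoef; fun_prop
    have := (hc.tendsto mu).mono_left (nhdsWithin_le_nhds (s := {mu}ᶜ))
    simpa [CubicDilatation.qCoef] using this
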